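/- **Lemma 2.3 (Self-adjointness).** Let $V:\mathbb{R}^3\to\mathbb{R}$ be a measurable function in the Kato class, that is, $$\lim_{r\to0+}\ \sup_{x\in\mathbb{R}^3}\int_{|x-y|\leq r}\frac{|V(y)|}{|x-y|}\,dy=0,$$ and let $\mathcal{H}u:=-\Delta u+Vu$, in the sense of distributions, for $u\in H^1(\mathbb{R}^3)$ (complex-valued); here $Vu$ is a tempered distribution for every $u\in H^1$. Write $q(u,u)=\|\nabla u\|_{L^2}^2+\int_{\mathbb{R}^3}V|u|^2dx$. Then for all sufficiently large $a\in\mathbb{R}$ (depending on $V$) one has, for every $u\in H^1$, that $V|u|^2$ is integrable and $$\tfrac12\|\nabla u\|_{L^2}^2-a\|u\|_{L^2}^2\leq q(u,u)\leq\tfrac32\|\nabla u\|_{L^2}^2+a\|u\|_{L^2}^2. \qquad (*)$$ Moreover, for every $a\in\mathbb{R}$ such that $(*)$ holds for all $u\in H^1$: 1. $\mathcal{H}+a+1$ is a bijection from $H^1$ onto $H^{-1}$, so that $\mathfrak{H}^2:=(\mathcal{H}+a+1)^{-1}(L^2)=\{u\in H^1:\ (\mathcal{H}+a+1)u\in L^2\}$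 is well defined; 2. $u\mapsto\mathcal{H}u$ with domain $\mathfrak{H}^2$ is a self-adjoint operator on $L^2(\mathbb{R}^3)$. -/

import Mathlib

namespace Schrodinger

open MeasureTheory Filter Topology
open scoped SchwartzMap LineDeriv Laplacian ENNReal

noncomputable section

/-- Euclidean space `ℝ³`. -/
abbrev R3 : Type := EuclideanSpace ℝ (Fin 3)

/-- The complex Hilbert space `L²(ℝ³)`. -/
abbrev L2 : Type := Lp ℂ 2 (volume : Measure R3)

/-- The Kato class: real-valued measurable `V` on `ℝ³` with
`lim_{r → 0+} sup_x ∫_{|x - y| ≤ r} |V y| / |x - y| dy = 0`. The integral and the supremum are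
taken in `[0, ∞]`; the convergence to `0` forces them to be finite for small `r`. -/
def KatoClass (V : R3 → ℝ) : Prop :=
  AEMeasurable V (volume : Measure R3) ∧
    Tendsto (fun r : ℝ => ⨆ x : R3, ∫⁻ y in Metric.closedBall x r, ‖V y‖ₑ / ‖x - y‖ₑ)
      (𝓝[>] 0) (𝓝 0)

/-- An `L²` function regarded as a tempered distribution. -/
def toDist (u : L2) : 𝓢'(R3, ℂ) := Lp.toTemperedDistribution u

/-- The Sobolev space `H¹(ℝ³)`, as a subset of `L²(ℝ³)`. -/
def H1 : Set L2 := {u | TemperedDistribution.MemSobolev 1 2 (toDist u)}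

/-- The Sobolev space `H⁻¹(ℝ³)`. -/
def Hneg1 : Set 𝓢'(R3, ℂ) := {T | TemperedDistribution.MemSobolev (-1) 2 T}

/-- `g = (g₁, g₂, g₃)` is the distributional gradient of `u`. -/
def HasGradient (u : L2) (g : Fin 3 → L2) : Prop :=
  ∀ i, ∂_{EuclideanSpace.single i (1 : ℝ)} (toDist u) = toDist (g i)

/-- `T` is the regular tempered distribution `φ ↦ ∫ φ w` given by the function `w`. -/
def IsRegular (w : R3 → ℂ) (T : 𝓢'(R3, ℂ)) : Prop :=
  ∀ φ : 𝓢(R3, ℂ), Integrable (fun x => φ x * w x) ∧ T φ = ∫ x, φ x * w x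

open Classical in
/-- The function `w` regarded as a tempered distribution (`0` if it does not define one). -/
def regular (w : R3 → ℂ) : 𝓢'(R3, ℂ) :=
  if h : ∃ T, IsRegular w T then h.choose else 0

/-- The function `V u`. -/
def potential (V : R3 → ℝ) (u : L2) : R3 → ℂ := fun x => (V x : ℂ) * u x

/-- The distribution `𝓗 u = -Δ u + V u`. -/
def hamiltonian (V : R3 → ℝ) (u : L2) : 𝓢'(R3, ℂ) :=
  -Δ (toDist u) + regular (potential V u)

/-- The distribution `(𝓗 + a + 1) u`. -/
def shifted (V : R3 → ℝ) (a : ℝ) (u : L2) : 𝓢'(R3, ℂ) :=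
  hamiltonian V u + ((a : ℂ) + 1) • toDist u

/-- The two-sided bound
`½ ‖∇u‖² - a ‖u‖² ≤ q(u, u) ≤ (3/2) ‖∇u‖² + a ‖u‖²` on `H¹` for the quadratic form
`q(u, u) = ∫ u conj(𝓗 u) = ‖∇u‖² + ∫ V |u|²`. -/
def FormBound (V : R3 → ℝ) (a : ℝ) : Prop :=
  ∀ u ∈ H1, ∀ g : Fin 3 → L2, HasGradient u g →
    Integrable (fun x => V x * ‖u x‖ ^ 2) ∧
    1 / 2 * (∑ i, ‖g i‖ ^ 2) - a * ‖u‖ ^ 2 ≤ (∑ i, ‖g i‖ ^ 2) + (∫ x, V x * ‖u x‖ ^ 2) ∧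
    (∑ i, ‖g i‖ ^ 2) + (∫ x, V x * ‖u x‖ ^ 2) ≤ 3 / 2 * (∑ i, ‖g i‖ ^ 2) + a * ‖u‖ ^ 2

/-- `𝔥² = (𝓗 + a + 1)⁻¹(L²)`, the set of those `u ∈ H¹` for which `(𝓗 + a + 1) u`, a priori a
distribution, is in `L²`. -/
def h2 (V : R3 → ℝ) (a : ℝ) : Set L2 := {u | u ∈ H1 ∧ shifted V a u ∈ Set.range toDist}

end

end Schrodinger

namespace Schrodinger

open MeasureTheory Filter Topology Set FourierTransform
open scoped SchwartzMap LineDeriv Laplacian ENNReal ComplexConjugate Real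

noncomputable section

/-- The heat kernel `(4πt)^{-3/2} exp(-|z|² / 4t)` on `ℝ³`. -/
def heat (t : ℝ) (z : R3) : ℝ := (4 * π * t) ^ (-3 / 2 : ℝ) * Real.exp (-‖z‖ ^ 2 / (4 * t))

/-- The kernel of `(-Δ + l)⁻¹`, as the Laplace transform of the heat kernel. -/
def resolventKernel (l : ℝ) (z : R3) : ℝ≥0∞ :=
  ∫⁻ t in Ioi (0 : ℝ), ENNReal.ofReal (Real.exp (-l * t) * heat t z)

lemma heat_nonneg {t : ℝ} (ht : 0 < t) (z : R3) : 0 ≤ heat t z := by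
  unfold heat; positivity

lemma heat_neg (t : ℝ) (z : R3) : heat t (-z) = heat t z := by
  simp [heat]

lemma heat_le_rpow {t : ℝ} (ht : 0 < t) (z : R3) : heat t z ≤ t ^ (-3 / 2 : ℝ) := by
  have h1 : (4 * π * t) ^ (-3 / 2 : ℝ) ≤ t ^ (-3 / 2 : ℝ) := by
    apply Real.rpow_le_rpow_of_nonpos ht _ (by norm_num)
    nlinarith [Real.pi_gt_three]
  have h2 : Real.exp (-‖z‖ ^ 2 / (4 * t)) ≤ 1 := by
    rw [Real.exp_le_one_iff]
    apply div_nonpos_of_nonpos_of_nonneg <;> nlinarith [sq_nonneg ‖z‖]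
  calc heat t z ≤ (4 * π * t) ^ (-3 / 2 : ℝ) * 1 := by unfold heat; gcongr
    _ ≤ _ := by simpa using h1

lemma heat_le_div {t : ℝ} (ht : 0 < t) {z : R3} (hz : z ≠ 0) :
    heat t z ≤ 32 / ‖z‖ ^ 4 * t ^ (1 / 2 : ℝ) := by
  have h1 : (4 * π * t) ^ (-3 / 2 : ℝ) ≤ t ^ (-3 / 2 : ℝ) := by
    apply Real.rpow_le_rpow_of_nonpos ht _ (by norm_num)
    nlinarith [Real.pi_gt_three]
  have hz' : 0 < ‖z‖ := norm_pos_iff.mpr hz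
  have h2 : Real.exp (-‖z‖ ^ 2 / (4 * t)) ≤ 32 / ‖z‖ ^ 4 * t ^ 2 := by
    set s := ‖z‖ ^ 2 / (4 * t) with hs
    have hs0 : 0 < s := by positivity
    have h3 : s ^ 2 / 2 ≤ Real.exp s := by
      nlinarith [Real.quadratic_le_exp_of_nonneg hs0.le]
    have : -‖z‖ ^ 2 / (4 * t) = -s := by rw [hs]; ring
    rw [this, Real.exp_neg]
    calc (Real.exp s)⁻¹ ≤ (s ^ 2 / 2)⁻¹ := by gcongr
      _ = _ := by rw [hs]; field_simp; norm_num
  calc heat t z ≤ t ^ (-3 / 2 : ℝ) * (32 / ‖z‖ ^ 4 * t ^ 2) := by unfold heat; gcongr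
    _ = 32 / ‖z‖ ^ 4 * (t ^ (-3 / 2 : ℝ) * t ^ (2 : ℝ)) := by norm_cast; ring
    _ = _ := by rw [← Real.rpow_add ht]; norm_num

lemma resolventKernel_le_inv {l : ℝ} (hl : 0 ≤ l) (z : R3) :
    resolventKernel l z ≤ 24 / ‖z‖ₑ := by
  rcases eq_or_ne z 0 with rfl | hz
  · simp [ENNReal.div_zero]
  have hz' : 0 < ‖z‖ := norm_pos_iff.mpr hz
  have hle : ∀ t : ℝ, 0 < t → Real.exp (-l * t) * heat t z ≤ heat t z := by
    intro t ht
    apply mul_le_of_le_one_left (heat_nonneg ht z)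
    rw [Real.exp_le_one_iff]; nlinarith
  have hI : Ioi (0 : ℝ) = Ioc 0 (‖z‖ ^ 2) ∪ Ioi (‖z‖ ^ 2) :=
    (Ioc_union_Ioi_eq_Ioi (by positivity)).symm
  have h1 : ∫⁻ t in Ioc 0 (‖z‖ ^ 2), ENNReal.ofReal (Real.exp (-l * t) * heat t z) ≤
      ENNReal.ofReal (22 / ‖z‖) := by
    calc _ ≤ ∫⁻ t in Ioc 0 (‖z‖ ^ 2), ENNReal.ofReal (32 / ‖z‖ ^ 4 * t ^ (1 / 2 : ℝ)) := by
          apply setLIntegral_mono' measurableSet_Ioc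
          intro t ht
          exact ENNReal.ofReal_le_ofReal ((hle t ht.1).trans (heat_le_div ht.1 hz))
      _ = ENNReal.ofReal (∫ t in Ioc 0 (‖z‖ ^ 2), 32 / ‖z‖ ^ 4 * t ^ (1 / 2 : ℝ)) := by
          rw [ofReal_integral_eq_lintegral_ofReal]
          · rw [← IntegrableOn, ← intervalIntegrable_iff_integrableOn_Ioc_of_le (by positivity)]
            exact (intervalIntegral.intervalIntegrable_rpow' (by norm_num)).const_mul _
          · filter_upwards [self_mem_ae_restrict measurableSet_Ioc] with t ht
            have := ht.1
            simp only [Pi.zero_apply]; positivity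
      _ ≤ _ := by
          apply ENNReal.ofReal_le_ofReal
          rw [← intervalIntegral.integral_of_le (by positivity), intervalIntegral.integral_const_mul,
            integral_rpow (by left; norm_num)]
          have : (‖z‖ ^ 2 : ℝ) ^ (1 / 2 + 1 : ℝ) = ‖z‖ ^ 3 := by
            rw [← Real.rpow_natCast, ← Real.rpow_mul hz'.le, ← Real.rpow_natCast]; norm_num
          rw [this, Real.zero_rpow (by norm_num)]
          rw [show 32 / ‖z‖ ^ 4 * ((‖z‖ ^ 3 - 0) / (1 / 2 + 1)) = (64 / 3) / ‖z‖ by field_simp; ring]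
          gcongr; norm_num
  have h2 : ∫⁻ t in Ioi (‖z‖ ^ 2), ENNReal.ofReal (Real.exp (-l * t) * heat t z) ≤
      ENNReal.ofReal (2 / ‖z‖) := by
    have hz2 : 0 < ‖z‖ ^ 2 := by positivity
    calc _ ≤ ∫⁻ t in Ioi (‖z‖ ^ 2), ENNReal.ofReal (t ^ (-3 / 2 : ℝ)) := by
          apply setLIntegral_mono' measurableSet_Ioi
          intro t ht
          have ht0 : 0 < t := lt_trans (by positivity) ht
          exact ENNReal.ofReal_le_ofReal ((hle t ht0).trans (heat_le_rpow ht0 z))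
      _ = ENNReal.ofReal (∫ t in Ioi (‖z‖ ^ 2), t ^ (-3 / 2 : ℝ)) := by
          rw [ofReal_integral_eq_lintegral_ofReal]
          · exact integrableOn_Ioi_rpow_of_lt (by norm_num) hz2
          · filter_upwards [self_mem_ae_restrict measurableSet_Ioi] with t ht
            have ht0 : 0 < t := lt_trans (by positivity) ht
            simp only [Pi.zero_apply]; positivity
      _ ≤ _ := by
          apply ENNReal.ofReal_le_ofReal
          rw [integral_Ioi_rpow_of_lt (by norm_num) hz2]
          have : (‖z‖ ^ 2 : ℝ) ^ (-3 / 2 + 1 : ℝ) = ‖z‖⁻¹ := by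
            rw [← Real.rpow_natCast, ← Real.rpow_mul hz'.le, ← Real.rpow_neg_one]; norm_num
          rw [this]
          apply le_of_eq; field_simp; norm_num
  unfold resolventKernel
  rw [hI]
  refine (lintegral_union_le _ _ _).trans ((add_le_add h1 h2).trans ?_)
  rw [← ENNReal.ofReal_add (by positivity) (by positivity), ← add_div, ENNReal.ofReal_div_of_pos hz',
    ofReal_norm]
  norm_num

lemma resolventKernel_le_tail :
    ∃ C : ℝ, 0 < C ∧ ∀ l : ℝ, 0 < l → ∀ z : R3, z ≠ 0 →
      resolventKernel l z ≤ ENNReal.ofReal (C / ‖z‖ ^ 4 * l⁻¹ ^ (3 / 2 : ℝ)) := by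
  refine ⟨32 * Real.Gamma (3 / 2), mul_pos (by norm_num) (Real.Gamma_pos_of_pos (by norm_num)), ?_⟩
  intro l hl z hz
  have hz' : 0 < ‖z‖ := norm_pos_iff.mpr hz
  have hint := Real.integral_rpow_mul_exp_neg_mul_Ioi (a := 3 / 2) (r := l) (by norm_num) hl
  have hi : IntegrableOn (fun t : ℝ => t ^ (3 / 2 - 1 : ℝ) * Real.exp (-(l * t))) (Ioi 0) := by
    apply Integrable.of_integral_ne_zero
    rw [hint]
    have := Real.Gamma_pos_of_pos (s := 3 / 2) (by norm_num)
    positivity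
  calc resolventKernel l z
      ≤ ∫⁻ t in Ioi (0 : ℝ), ENNReal.ofReal (32 / ‖z‖ ^ 4 *
          (t ^ (3 / 2 - 1 : ℝ) * Real.exp (-(l * t)))) := by
        apply setLIntegral_mono' measurableSet_Ioi
        intro t ht
        apply ENNReal.ofReal_le_ofReal
        have := heat_le_div ht hz
        rw [show (3 / 2 - 1 : ℝ) = 1 / 2 by norm_num, neg_mul]
        calc _ ≤ Real.exp (-(l * t)) * (32 / ‖z‖ ^ 4 * t ^ (1 / 2 : ℝ)) := by gcongr
          _ = _ := by ring
    _ = ENNReal.ofReal (∫ t in Ioi (0 : ℝ), 32 / ‖z‖ ^ 4 *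
          (t ^ (3 / 2 - 1 : ℝ) * Real.exp (-(l * t)))) := by
        rw [ofReal_integral_eq_lintegral_ofReal]
        · exact hi.const_mul _
        · filter_upwards [self_mem_ae_restrict measurableSet_Ioi] with t ht
          have : 0 < t := ht
          simp only [Pi.zero_apply]; positivity
    _ = _ := by
        rw [integral_const_mul, hint, one_div]; congr 1; ring

@[fun_prop]
lemma measurable_heat : Measurable (Function.uncurry heat) := by
  unfold heat Function.uncurry; fun_prop

@[fun_prop]
lemma measurable_resolventKernel (l : ℝ) : Measurable (resolventKernel l) := by
  have : Measurable fun p : R3 × ℝ => ENNReal.ofReal (Real.exp (-l * p.2) * heat p.2 p.1) := by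
    unfold heat; fun_prop
  exact this.lintegral_prod_right'

lemma resolventKernel_neg (l : ℝ) (z : R3) : resolventKernel l (-z) = resolventKernel l z := by
  simp [resolventKernel, heat_neg]

lemma lintegral_mul_decay_le (r : ℝ) (hr : 0 < r) (hr1 : r ≤ 1) :
    ∃ C : ℝ≥0∞, C ≠ ∞ ∧ ∀ (W : R3 → ℝ≥0∞) (K : ℝ≥0∞), AEMeasurable W →
      (∀ x, ∫⁻ y in Metric.closedBall x r, W y ≤ K) →
      ∀ x, ∫⁻ y, W y * ENNReal.ofReal ((1 + ‖x - y‖) ^ (-4 : ℝ)) ≤ C * K := by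
  set D : R3 → ℝ≥0∞ := fun z => ENNReal.ofReal ((1 + ‖z‖) ^ (-4 : ℝ)) with hD
  have hDm : Measurable D := by fun_prop
  set v : ℝ≥0∞ := volume (Metric.closedBall (0 : R3) r) with hv
  have hv0 : v ≠ 0 := (Metric.measure_closedBall_pos volume 0 hr).ne'
  have hvt : v ≠ ∞ := measure_closedBall_lt_top.ne
  have hDI : ∫⁻ z, D z < ∞ := finite_integral_one_add_norm (by simp; norm_num)
  refine ⟨v⁻¹ * (16 * ∫⁻ z, D z), ENNReal.mul_ne_top (by simpa using hv0)
    (ENNReal.mul_ne_top (by simp) hDI.ne), ?_⟩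
  intro W K hW hK x
  set B : Set (R3 × R3) := {p | ‖x - p.1 - p.2‖ ≤ r} with hB
  have hBm : MeasurableSet B := by
    apply IsClosed.measurableSet
    exact isClosed_le (by fun_prop) continuous_const
  have hpt : ∀ y, v * D (x - y) ≤ ∫⁻ w, B.indicator (fun p => 16 * D p.2) (y, w) := by
    intro y
    have h1 : v = volume (Metric.closedBall (x - y) r) := by
      rw [hv, Measure.addHaar_closedBall_center volume (x - y)]
    calc v * D (x - y) = ∫⁻ w in Metric.closedBall (x - y) r, D (x - y) := by
          rw [setLIntegral_const, ← h1, mul_comm]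
      _ ≤ ∫⁻ w in Metric.closedBall (x - y) r, 16 * D w := by
          apply setLIntegral_mono' measurableSet_closedBall
          intro w hw
          rw [Metric.mem_closedBall, dist_eq_norm] at hw
          have hle : 1 + ‖w‖ ≤ 2 * (1 + ‖x - y‖) := by
            have : ‖w‖ ≤ ‖w - (x - y)‖ + ‖x - y‖ := by
              simpa using norm_add_le (w - (x - y)) (x - y)
            linarith [norm_nonneg (x - y)]
          rw [hD, show (16 : ℝ≥0∞) = ENNReal.ofReal 16 by norm_num, ← ENNReal.ofReal_mul (by norm_num)]
          apply ENNReal.ofReal_le_ofReal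
          have h2 := Real.rpow_le_rpow_of_nonpos (z := -4) (by positivity) hle (by norm_num)
          rw [Real.mul_rpow (by norm_num) (by positivity)] at h2
          have h3 : (2 : ℝ) ^ (-4 : ℝ) = 1 / 16 := by
            rw [Real.rpow_neg (by norm_num)]; norm_num
          rw [h3] at h2
          linarith
      _ = _ := by
          rw [← lintegral_indicator measurableSet_closedBall]
          apply lintegral_congr
          intro w
          simp only [Set.indicator, hB, Metric.mem_closedBall, dist_eq_norm, mem_ofPred_eq]
          rw [norm_sub_rev w]
  have hind : Measurable (B.indicator fun p : R3 × R3 => 16 * D p.2) :=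
    Measurable.indicator (by fun_prop) hBm
  have key : v * ∫⁻ y, W y * D (x - y) ≤ 16 * (∫⁻ z, D z) * K := by
    calc v * ∫⁻ y, W y * D (x - y) = ∫⁻ y, W y * (v * D (x - y)) := by
          rw [← lintegral_const_mul' _ _ hvt]; congr 1; ext y; ring
      _ ≤ ∫⁻ y, ∫⁻ w, W y * B.indicator (fun p => 16 * D p.2) (y, w) := by
          apply lintegral_mono
          intro y
          simp only
          rw [lintegral_const_mul _ (by exact hind.comp (by fun_prop))]
          gcongr
          exact hpt y
      _ = ∫⁻ w, ∫⁻ y, W y * B.indicator (fun p => 16 * D p.2) (y, w) := by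
          apply lintegral_lintegral_swap
          exact (hW.comp_fst).mul hind.aemeasurable
      _ ≤ ∫⁻ w, 16 * D w * K := by
          apply lintegral_mono
          intro w
          calc _ = ∫⁻ y, (Metric.closedBall (x - w) r).indicator (fun y => 16 * D w * W y) y := by
                apply lintegral_congr
                intro y
                simp only [Set.indicator, hB, Metric.mem_closedBall, dist_eq_norm, mem_ofPred_eq]
                rw [norm_sub_rev y, sub_right_comm]
                split_ifs <;> ring
            _ = 16 * D w * ∫⁻ y in Metric.closedBall (x - w) r, W y := by
                rw [lintegral_indicator measurableSet_closedBall, lintegral_const_mul']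
                exact ENNReal.mul_ne_top (by simp) (by simp [hD])
            _ ≤ _ := by
                exact mul_le_mul_right (hK _) _
      _ = _ := by
          rw [lintegral_mul_const _ (by fun_prop), lintegral_const_mul _ hDm]
  calc ∫⁻ y, W y * D (x - y) = v⁻¹ * (v * ∫⁻ y, W y * D (x - y)) := by
        rw [← mul_assoc, ENNReal.inv_mul_cancel hv0 hvt, one_mul]
    _ ≤ v⁻¹ * (16 * (∫⁻ z, D z) * K) := by gcongr
    _ = _ := by ring

/-- The potentials of a Kato class function become uniformly small as the energy goes to `-∞`. -/
theorem KatoClass.exists_lintegral_resolventKernel_le {V : R3 → ℝ} (hV : KatoClass V)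
    {ε : ℝ≥0∞} (hε : 0 < ε) :
    ∃ l : ℝ, 0 < l ∧ ∀ x, ∫⁻ y, ‖V y‖ₑ * resolventKernel l (x - y) ≤ ε := by
  wlog hεt : ε ≠ ∞
  · simp only [ne_eq, not_not] at hεt
    exact ⟨1, one_pos, fun x => by simp [hεt]⟩
  obtain ⟨hVm, hlim⟩ := hV
  have hδ : 0 < ε / 48 := ENNReal.div_pos hε.ne' (by simp)
  have hev : ∀ᶠ r : ℝ in 𝓝[>] 0,
      ⨆ x : R3, ∫⁻ y in Metric.closedBall x r, ‖V y‖ₑ / ‖x - y‖ₑ ≤ ε / 48 := by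
    filter_upwards [hlim.eventually_lt_const hδ] with r hr using hr.le
  obtain ⟨r, hr, hr0, hr1⟩ := (hev.and (Ioc_mem_nhdsGT (zero_lt_one' ℝ))).exists
  have hball : ∀ x : R3, ∫⁻ y in Metric.closedBall x r, ‖V y‖ₑ / ‖x - y‖ₑ ≤ ε / 48 :=
    fun x => (le_iSup (fun x : R3 => ∫⁻ y in Metric.closedBall x r, ‖V y‖ₑ / ‖x - y‖ₑ) x).trans hr
  have hmass : ∀ x : R3, ∫⁻ y in Metric.closedBall x r, ‖V y‖ₑ ≤ ε / 48 := by
    intro x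
    refine le_trans (setLIntegral_mono' measurableSet_closedBall ?_) (hball x)
    intro y hy
    rw [Metric.mem_closedBall, dist_comm, dist_eq_norm] at hy
    calc ‖V y‖ₑ = ‖V y‖ₑ / 1 := by simp
      _ ≤ _ := by
        apply ENNReal.div_le_div_left
        rw [← ofReal_norm, ENNReal.ofReal_le_one]
        linarith
  obtain ⟨C, hC, hdecay⟩ := lintegral_mul_decay_le r hr0 hr1
  obtain ⟨c, hc, htail⟩ := resolventKernel_le_tail
  have hsmall : ∀ᶠ l : ℝ in atTop, ENNReal.ofReal (c * (2 / r) ^ 4 * l⁻¹ ^ (3 / 2 : ℝ)) *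
      (C * (ε / 48)) ≤ ε / 2 := by
    have h1 : Tendsto (fun l : ℝ => c * (2 / r) ^ 4 * l⁻¹ ^ (3 / 2 : ℝ)) atTop (𝓝 0) := by
      have := (tendsto_inv_atTop_zero (𝕜 := ℝ)).rpow_const (p := 3 / 2) (by right; norm_num)
      simpa using this.const_mul (c * (2 / r) ^ 4)
    have h2 : Tendsto (fun l : ℝ => ENNReal.ofReal (c * (2 / r) ^ 4 * l⁻¹ ^ (3 / 2 : ℝ)) *
        (C * (ε / 48))) atTop (𝓝 0) := by
      have h3 := ENNReal.tendsto_ofReal h1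
      have h4 := ENNReal.Tendsto.mul_const (b := C * (ε / 48)) h3
        (Or.inr (ENNReal.mul_ne_top hC (ENNReal.div_ne_top hεt (by simp))))
      simpa using h4
    filter_upwards [h2.eventually_lt_const (ENNReal.half_pos hε.ne')] with l hl using hl.le
  obtain ⟨l, hl, hl0⟩ := (hsmall.and (eventually_gt_atTop 0)).exists
  refine ⟨l, hl0, fun x => ?_⟩
  rw [← lintegral_add_compl _ (measurableSet_closedBall (x := x) (ε := r))]
  have hin : ∫⁻ y in Metric.closedBall x r, ‖V y‖ₑ * resolventKernel l (x - y) ≤ ε / 2 := by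
    calc _ ≤ ∫⁻ y in Metric.closedBall x r, 24 * (‖V y‖ₑ / ‖x - y‖ₑ) := by
          apply lintegral_mono
          intro y
          calc ‖V y‖ₑ * resolventKernel l (x - y) ≤ ‖V y‖ₑ * (24 / ‖x - y‖ₑ) := by
                gcongr; exact resolventKernel_le_inv hl0.le _
            _ = _ := by simp only [div_eq_mul_inv]; ring
      _ = 24 * ∫⁻ y in Metric.closedBall x r, ‖V y‖ₑ / ‖x - y‖ₑ :=
          lintegral_const_mul' _ _ (by simp)
      _ ≤ 24 * (ε / 48) := by gcongr; exact hball x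
      _ = ε / 2 := by
          rw [show (48 : ℝ≥0∞) = 24 * 2 by norm_num, div_eq_mul_inv, div_eq_mul_inv,
            ENNReal.mul_inv (by simp) (by simp),
            show (24 : ℝ≥0∞) * (ε * (24⁻¹ * 2⁻¹)) = (24 * 24⁻¹) * (ε * 2⁻¹) by ring,
            ENNReal.mul_inv_cancel (by simp) (by simp), one_mul]
  have hout : ∫⁻ y in (Metric.closedBall x r)ᶜ, ‖V y‖ₑ * resolventKernel l (x - y) ≤ ε / 2 := by
    calc _ ≤ ∫⁻ y in (Metric.closedBall x r)ᶜ, ENNReal.ofReal (c * (2 / r) ^ 4 * l⁻¹ ^ (3 / 2 : ℝ)) *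
            (‖V y‖ₑ * ENNReal.ofReal ((1 + ‖x - y‖) ^ (-4 : ℝ))) := by
          apply setLIntegral_mono' measurableSet_closedBall.compl
          intro y hy
          rw [mem_compl_iff, Metric.mem_closedBall, dist_comm, dist_eq_norm, not_le] at hy
          have hz : 0 < ‖x - y‖ := hr0.trans hy
          have hG := htail l hl0 (x - y) (norm_pos_iff.mp hz)
          have hle : c / ‖x - y‖ ^ 4 * l⁻¹ ^ (3 / 2 : ℝ) ≤
              c * (2 / r) ^ 4 * l⁻¹ ^ (3 / 2 : ℝ) * (1 + ‖x - y‖) ^ (-4 : ℝ) := by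
            rw [Real.rpow_neg (by positivity), show (4 : ℝ) = ((4 : ℕ) : ℝ) by norm_num,
              Real.rpow_natCast]
            have h1 : 1 + ‖x - y‖ ≤ 2 / r * ‖x - y‖ := by
              rw [div_mul_eq_mul_div, le_div_iff₀ hr0]; nlinarith
            have h2 : (1 + ‖x - y‖) ^ 4 ≤ (2 / r) ^ 4 * ‖x - y‖ ^ 4 := by
              rw [← mul_pow]; gcongr
            have h3 : 1 / ‖x - y‖ ^ 4 ≤ (2 / r) ^ 4 * ((1 + ‖x - y‖) ^ 4)⁻¹ := by
              rw [← div_eq_mul_inv, div_le_div_iff₀ (by positivity) (by positivity)]; linarith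
            calc _ = c * l⁻¹ ^ (3 / 2 : ℝ) * (1 / ‖x - y‖ ^ 4) := by ring
              _ ≤ c * l⁻¹ ^ (3 / 2 : ℝ) * ((2 / r) ^ 4 * ((1 + ‖x - y‖) ^ 4)⁻¹) := by gcongr
              _ = _ := by ring
          calc ‖V y‖ₑ * resolventKernel l (x - y)
              ≤ ‖V y‖ₑ * ENNReal.ofReal (c * (2 / r) ^ 4 * l⁻¹ ^ (3 / 2 : ℝ) *
                  (1 + ‖x - y‖) ^ (-4 : ℝ)) := by
                gcongr
                exact hG.trans (ENNReal.ofReal_le_ofReal hle)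
            _ = _ := by
                rw [ENNReal.ofReal_mul (by positivity)]; ring
      _ = ENNReal.ofReal (c * (2 / r) ^ 4 * l⁻¹ ^ (3 / 2 : ℝ)) *
            ∫⁻ y in (Metric.closedBall x r)ᶜ, ‖V y‖ₑ * ENNReal.ofReal ((1 + ‖x - y‖) ^ (-4 : ℝ)) :=
          lintegral_const_mul' _ _ (by simp)
      _ ≤ ENNReal.ofReal (c * (2 / r) ^ 4 * l⁻¹ ^ (3 / 2 : ℝ)) * (C * (ε / 48)) := by
          gcongr
          exact (setLIntegral_le_lintegral _ _).trans (hdecay _ _ hVm.enorm hmass x)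
      _ ≤ _ := hl
  calc _ ≤ ε / 2 + ε / 2 := add_le_add hin hout
    _ = ε := ENNReal.add_halves ε

/-- Locally integrable functions that define the same tempered distribution agree a.e. -/
lemma ae_eq_of_forall_integral_schwartz_eq {F₁ F₂ : R3 → ℂ} (h₁ : LocallyIntegrable F₁)
    (h₂ : LocallyIntegrable F₂) (h : ∀ φ : 𝓢(R3, ℂ), ∫ x, φ x * F₁ x = ∫ x, φ x * F₂ x) :
    F₁ =ᵐ[volume] F₂ := by
  apply ae_eq_of_integral_contDiff_smul_eq h₁ h₂
  intro g g_smooth g_cpt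
  have hg₁ : HasCompactSupport (Complex.ofRealCLM ∘ g) := g_cpt.comp_left rfl
  have hg₂ : ContDiff ℝ ((⊤ : ℕ∞) : WithTop ℕ∞) (Complex.ofRealCLM ∘ g) := by fun_prop
  simpa using h (hg₁.toSchwartzMap hg₂)

lemma toDist_apply (u : L2) (φ : 𝓢(R3, ℂ)) : toDist u φ = ∫ x, φ x * u x := by
  simp [toDist, Lp.toTemperedDistribution_apply]

lemma locallyIntegrable_coe (u : L2) : LocallyIntegrable (u : R3 → ℂ) :=
  (Lp.memLp u).locallyIntegrable (by norm_num)

lemma integral_fourier_mul_eq_of_integrable {f g : R3 → ℂ} (hf : Integrable f) (hg : Integrable g) :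
    ∫ ξ, 𝓕 f ξ * g ξ = ∫ x, f x * 𝓕 g x := by
  have := VectorFourier.integral_fourierIntegral_smul_eq_flip (μ := volume) (ν := volume)
    (L := innerₗ R3) (e := Real.fourierChar) (f := f) (g := g) Real.continuous_fourierChar
    (by simpa using continuous_inner) hf hg
  simpa [flip_innerₗ] using! this

lemma continuous_fourier_of_integrable {f : R3 → ℂ} (hf : Integrable f) : Continuous (𝓕 f) :=
  VectorFourier.fourierIntegral_continuous Real.continuous_fourierChar
    (by simpa using continuous_inner) hf

lemma norm_fourier_le (f : R3 → ℂ) (ξ : R3) : ‖𝓕 f ξ‖ ≤ ∫ x, ‖f x‖ :=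
  VectorFourier.norm_fourierIntegral_le_integral_norm _ _ _ _ _

/-- On `L¹ ∩ L²` the `L²` Fourier transform is given by the Fourier integral. -/
lemma coe_fourier_toLp {f : R3 → ℂ} (hf : Integrable f) (hf2 : MemLp f 2) :
    ((𝓕 (hf2.toLp f) : L2) : R3 → ℂ) =ᵐ[volume] 𝓕 f := by
  apply ae_eq_of_forall_integral_schwartz_eq (locallyIntegrable_coe _)
    (continuous_fourier_of_integrable hf).locallyIntegrable
  intro φ
  calc ∫ x, φ x * (𝓕 (hf2.toLp f) : L2) x = toDist (𝓕 (hf2.toLp f)) φ := (toDist_apply _ _).symm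
    _ = (𝓕 (toDist (hf2.toLp f))) φ := by
        rw [toDist, toDist, Lp.fourier_toTemperedDistribution_eq]
    _ = ∫ x, 𝓕 φ x * f x := by
        rw [TemperedDistribution.fourier_apply, toDist_apply]
        apply integral_congr_ae
        filter_upwards [hf2.coeFn_toLp] with x hx using by rw [hx]
    _ = ∫ x, φ x * 𝓕 f x := by
        rw [SchwartzMap.fourier_coe, integral_fourier_mul_eq_of_integrable φ.integrable hf]

lemma integrable_gaussian {b : ℝ} (hb : 0 < b) :
    Integrable (fun ξ : R3 => Real.exp (-b * ‖ξ‖ ^ 2)) := by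
  have := (GaussianFourier.integrable_cexp_neg_mul_sq_norm_add (V := R3) (b := b) (by simpa using hb)
    0 0).norm
  refine this.congr (ae_of_all _ fun ξ => ?_)
  simp only [Complex.norm_exp]
  norm_cast
  simp

lemma fourier_modulated_gaussian {t : ℝ} (ht : 0 < t) (x y : R3) :
    𝓕 (fun ξ : R3 => (Real.exp (-(4 * π ^ 2 * t) * ‖ξ‖ ^ 2) : ℂ) *
      Complex.exp (2 * π * Complex.I * (inner ℝ x ξ : ℝ))) y = heat t (x - y) := by
  have h := fourier_gaussian_innerProductSpace' (V := R3) (b := (4 * π ^ 2 * t : ℝ))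
    (by rw [Complex.ofReal_re]; positivity) x y
  have hL : (fun ξ : R3 => (Real.exp (-(4 * π ^ 2 * t) * ‖ξ‖ ^ 2) : ℂ) *
      Complex.exp (2 * π * Complex.I * (inner ℝ x ξ : ℝ))) =
      fun ξ : R3 => Complex.exp (-((4 * π ^ 2 * t : ℝ) : ℂ) * ‖ξ‖ ^ 2 +
        2 * π * Complex.I * (inner ℝ x ξ : ℝ)) := by
    ext ξ
    rw [Complex.exp_add]; push_cast; rfl
  rw [hL, h]
  have h1 : ((π : ℂ) / (4 * π ^ 2 * t : ℝ)) = ((4 * π * t)⁻¹ : ℝ) := by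
    have := Real.pi_ne_zero
    rw [← Complex.ofReal_div]; congr 1; field_simp
  have h2 : ((Module.finrank ℝ R3 : ℂ) / 2) = ((3 / 2 : ℝ) : ℂ) := by simp
  have h3 : -(π : ℂ) ^ 2 * (‖x - y‖ : ℂ) ^ 2 / (4 * π ^ 2 * t : ℝ) =
      ((-‖x - y‖ ^ 2 / (4 * t) : ℝ) : ℂ) := by
    have := Real.pi_ne_zero
    have ht' := ht.ne'
    norm_cast; field_simp
  rw [h1, h2, h3, ← Complex.ofReal_cpow (by positivity), ← Complex.ofReal_exp, ← Complex.ofReal_mul,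
    heat, Real.inv_rpow (by positivity), ← Real.rpow_neg (by positivity)]
  norm_num

lemma enorm_fourier_gaussian_mul_le {f : R3 → ℂ} (hf : Integrable f) {t : ℝ} (ht : 0 < t) (x : R3) :
    ‖𝓕 (fun ξ : R3 => (Real.exp (-(4 * π ^ 2 * t) * ‖ξ‖ ^ 2) : ℂ) * conj (𝓕 f ξ)) x‖ₑ ≤
      ∫⁻ y, ‖f y‖ₑ * ENNReal.ofReal (heat t (x - y)) := by
  have hg := integrable_gaussian (b := 4 * π ^ 2 * t) (by positivity)
  have hgx : Integrable (fun ξ : R3 => (Real.exp (-(4 * π ^ 2 * t) * ‖ξ‖ ^ 2) : ℂ) *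
      Complex.exp (2 * π * Complex.I * (inner ℝ x ξ : ℝ))) := by
    refine hg.mono' (by fun_prop) (ae_of_all _ fun ξ => ?_)
    rw [norm_mul, Complex.norm_real, Real.norm_of_nonneg (Real.exp_pos _).le]
    apply mul_le_of_le_one_right (Real.exp_pos _).le
    rw [show 2 * (π : ℂ) * Complex.I * (inner ℝ x ξ : ℝ) =
      ((2 * π * inner ℝ x ξ : ℝ) : ℂ) * Complex.I by push_cast; ring, Complex.norm_exp_ofReal_mul_I]
  have key : conj (𝓕 (fun ξ : R3 => (Real.exp (-(4 * π ^ 2 * t) * ‖ξ‖ ^ 2) : ℂ) *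
      conj (𝓕 f ξ)) x) = ∫ y, f y * (heat t (x - y) : ℂ) := by
    have h1 := integral_fourier_mul_eq_of_integrable hf hgx
    simp_rw [fourier_modulated_gaussian ht] at h1
    rw [← h1, Real.fourier_eq', ← integral_conj]
    congr 1
    ext ξ
    rw [smul_eq_mul, map_mul, map_mul, Complex.conj_conj, ← Complex.exp_conj, Complex.conj_ofReal,
      map_mul, Complex.conj_I, Complex.conj_ofReal, real_inner_comm]
    rw [show ((-2 * π * inner ℝ x ξ : ℝ) : ℂ) * -Complex.I =
      2 * π * Complex.I * (inner ℝ x ξ : ℝ) by push_cast; ring]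
    ring
  rw [← RCLike.enorm_conj, key]
  refine (enorm_integral_le_lintegral_enorm _).trans (le_of_eq (lintegral_congr fun y => ?_))
  rw [enorm_mul, ← ofReal_norm (E := ℂ) (heat t (x - y) : ℂ), Complex.norm_real,
    Real.norm_of_nonneg (heat_nonneg ht _)]

lemma lintegral_gaussian_mul_fourier_sq_le {f : R3 → ℂ} (hf : Integrable f) {t : ℝ} (ht : 0 < t) :
    ∫⁻ ξ, ENNReal.ofReal (Real.exp (-(4 * π ^ 2 * t) * ‖ξ‖ ^ 2)) * ‖𝓕 f ξ‖ₑ ^ 2 ≤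
      ∫⁻ x, ∫⁻ y, ‖f x‖ₑ * (‖f y‖ₑ * ENNReal.ofReal (heat t (x - y))) := by
  have hg := integrable_gaussian (b := 4 * π ^ 2 * t) (by positivity)
  have hc := continuous_fourier_of_integrable hf
  have hgf : Integrable (fun ξ : R3 => (Real.exp (-(4 * π ^ 2 * t) * ‖ξ‖ ^ 2) : ℂ) *
      conj (𝓕 f ξ)) := by
    refine (hg.mul_const (∫ x, ‖f x‖)).mono' ?_ (ae_of_all _ fun ξ => ?_)
    · exact (by fun_prop : Continuous _).aestronglyMeasurable
    · rw [norm_mul, Complex.norm_real, Real.norm_of_nonneg (Real.exp_pos _).le, RCLike.norm_conj]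
      gcongr
      exact norm_fourier_le f ξ
  have hint : Integrable (fun ξ : R3 => Real.exp (-(4 * π ^ 2 * t) * ‖ξ‖ ^ 2) * ‖𝓕 f ξ‖ ^ 2) := by
    refine (hg.mul_const ((∫ x, ‖f x‖) ^ 2)).mono' ?_ (ae_of_all _ fun ξ => ?_)
    · exact (by fun_prop : Continuous _).aestronglyMeasurable
    · rw [norm_mul, Real.norm_of_nonneg (Real.exp_pos _).le, norm_pow, norm_norm]
      gcongr
      exact norm_fourier_le f ξ
  have hL : ∫⁻ ξ, ENNReal.ofReal (Real.exp (-(4 * π ^ 2 * t) * ‖ξ‖ ^ 2)) * ‖𝓕 f ξ‖ₑ ^ 2 =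
      ‖∫ ξ, 𝓕 f ξ * ((Real.exp (-(4 * π ^ 2 * t) * ‖ξ‖ ^ 2) : ℂ) * conj (𝓕 f ξ))‖ₑ := by
    have h1 : ∀ ξ, 𝓕 f ξ * ((Real.exp (-(4 * π ^ 2 * t) * ‖ξ‖ ^ 2) : ℂ) * conj (𝓕 f ξ)) =
        ((Real.exp (-(4 * π ^ 2 * t) * ‖ξ‖ ^ 2) * ‖𝓕 f ξ‖ ^ 2 : ℝ) : ℂ) := by
      intro ξ
      rw [mul_left_comm, Complex.mul_conj']
      push_cast; rfl
    simp_rw [h1]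
    rw [integral_complex_ofReal, ← ofReal_norm, Complex.norm_real, Real.norm_of_nonneg
      (integral_nonneg fun ξ => by positivity), ofReal_integral_eq_lintegral_ofReal hint
      (ae_of_all _ fun ξ => by positivity)]
    apply lintegral_congr
    intro ξ
    rw [ENNReal.ofReal_mul (Real.exp_pos _).le, ENNReal.ofReal_pow (norm_nonneg _), ofReal_norm]
  rw [hL, integral_fourier_mul_eq_of_integrable hf hgf]
  refine (enorm_integral_le_lintegral_enorm _).trans (lintegral_mono fun x => ?_)
  rw [enorm_mul, lintegral_const_mul' _ _ (by simp)]
  gcongr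
  exact enorm_fourier_gaussian_mul_le hf ht x

lemma ofReal_inv_eq_lintegral_exp {c : ℝ} (hc : 0 < c) :
    (ENNReal.ofReal c)⁻¹ = ∫⁻ t in Ioi (0 : ℝ), ENNReal.ofReal (Real.exp (-c * t)) := by
  rw [← ofReal_integral_eq_lintegral_ofReal (integrableOn_exp_mul_Ioi (by linarith) 0)
    (ae_of_all _ fun t => (Real.exp_pos _).le), integral_exp_mul_Ioi (by linarith),
    ← ENNReal.ofReal_inv_of_pos hc]
  congr 1; simp [neg_div_neg_eq]

/-- The `H⁻¹` energy of `f` is bounded by its energy with respect to the resolvent kernel. -/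
lemma lintegral_fourier_sq_div_le {f : R3 → ℂ} (hf : Integrable f) (hfm : StronglyMeasurable f)
    {l : ℝ} (hl : 0 < l) :
    ∫⁻ ξ, ‖𝓕 f ξ‖ₑ ^ 2 * (ENNReal.ofReal (4 * π ^ 2 * ‖ξ‖ ^ 2 + l))⁻¹ ≤
      ∫⁻ x, ∫⁻ y, ‖f x‖ₑ * (‖f y‖ₑ * resolventKernel l (x - y)) := by
  have hc := continuous_fourier_of_integrable hf
  have hfe : Measurable fun x => ‖f x‖ₑ := hfm.enorm
  have hheat : Measurable fun p : ℝ × R3 => heat p.1 p.2 := measurable_heat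
  have hker : Measurable fun p : (ℝ × R3) × R3 => ENNReal.ofReal (Real.exp (-l * p.1.1)) *
      (‖f p.1.2‖ₑ * (‖f p.2‖ₑ * ENNReal.ofReal (heat p.1.1 (p.1.2 - p.2)))) := by
    have h1 : Measurable fun p : (ℝ × R3) × R3 => heat p.1.1 (p.1.2 - p.2) :=
      hheat.comp (by fun_prop : Measurable fun p : (ℝ × R3) × R3 => (p.1.1, p.1.2 - p.2))
    have h2 : Measurable fun p : (ℝ × R3) × R3 => ‖f p.1.2‖ₑ := hfe.comp (by fun_prop)
    have h3 : Measurable fun p : (ℝ × R3) × R3 => ‖f p.2‖ₑ := hfe.comp (by fun_prop)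
    fun_prop
  calc ∫⁻ ξ, ‖𝓕 f ξ‖ₑ ^ 2 * (ENNReal.ofReal (4 * π ^ 2 * ‖ξ‖ ^ 2 + l))⁻¹
      = ∫⁻ ξ, ∫⁻ t in Ioi (0 : ℝ), ENNReal.ofReal (Real.exp (-l * t)) *
          (ENNReal.ofReal (Real.exp (-(4 * π ^ 2 * t) * ‖ξ‖ ^ 2)) * ‖𝓕 f ξ‖ₑ ^ 2) := by
        apply lintegral_congr
        intro ξ
        rw [ofReal_inv_eq_lintegral_exp (by positivity), ← lintegral_const_mul' _ _ (by simp)]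
        apply lintegral_congr
        intro t
        rw [← mul_assoc, ← ENNReal.ofReal_mul (Real.exp_pos _).le, ← Real.exp_add, mul_comm]
        ring_nf
    _ = ∫⁻ t in Ioi (0 : ℝ), ∫⁻ ξ, ENNReal.ofReal (Real.exp (-l * t)) *
          (ENNReal.ofReal (Real.exp (-(4 * π ^ 2 * t) * ‖ξ‖ ^ 2)) * ‖𝓕 f ξ‖ₑ ^ 2) := by
        apply lintegral_lintegral_swap
        apply Measurable.aemeasurable
        have h1 : Measurable fun p : R3 × ℝ => ‖𝓕 f p.1‖ₑ :=
          (hc.measurable.comp measurable_fst).enorm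
        unfold Function.uncurry
        fun_prop
    _ ≤ ∫⁻ t in Ioi (0 : ℝ), ∫⁻ x, ∫⁻ y, ENNReal.ofReal (Real.exp (-l * t)) *
          (‖f x‖ₑ * (‖f y‖ₑ * ENNReal.ofReal (heat t (x - y)))) := by
        apply setLIntegral_mono' measurableSet_Ioi
        intro t ht
        rw [lintegral_const_mul' _ _ (by simp)]
        simp_rw [lintegral_const_mul' (ENNReal.ofReal (Real.exp (-l * t))) _ (by simp)]
        exact mul_le_mul_right (lintegral_gaussian_mul_fourier_sq_le hf ht) _
    _ = ∫⁻ x, ∫⁻ t in Ioi (0 : ℝ), ∫⁻ y, ENNReal.ofReal (Real.exp (-l * t)) *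
          (‖f x‖ₑ * (‖f y‖ₑ * ENNReal.ofReal (heat t (x - y)))) := by
        apply lintegral_lintegral_swap
        exact hker.lintegral_prod_right'.aemeasurable
    _ = ∫⁻ x, ∫⁻ y, ∫⁻ t in Ioi (0 : ℝ), ENNReal.ofReal (Real.exp (-l * t)) *
          (‖f x‖ₑ * (‖f y‖ₑ * ENNReal.ofReal (heat t (x - y)))) := by
        apply lintegral_congr
        intro x
        apply lintegral_lintegral_swap
        exact (hker.comp (by fun_prop :
          Measurable fun p : ℝ × R3 => ((p.1, x), p.2))).aemeasurable
    _ = _ := by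
        apply lintegral_congr
        intro x
        apply lintegral_congr
        intro y
        rw [resolventKernel, ← lintegral_const_mul' _ _ (by simp), ← lintegral_const_mul' _ _ (by simp)]
        apply lintegral_congr
        intro t
        rw [ENNReal.ofReal_mul (Real.exp_pos _).le]
        ring

lemma inner_eq_integral (u v : L2) : inner ℂ u v = ∫ x, conj (u x) * v x := by
  rw [L2.inner_def]
  simp [RCLike.inner_apply, mul_comm]

lemma lintegral_kernel_le {W : R3 → ℝ≥0∞} (hW : Measurable W) {u : R3 → ℂ} (hu : Measurable u)
    {l : ℝ} {M : ℝ≥0∞} (hM : ∀ x, ∫⁻ y, W y * resolventKernel l (x - y) ≤ M) :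
    ∫⁻ x, ∫⁻ y, W x * ‖u x‖ₑ * (W y * ‖u y‖ₑ * resolventKernel l (x - y)) ≤
      2 * M * ∫⁻ x, W x * ‖u x‖ₑ ^ 2 := by
  have hue : Measurable fun x => ‖u x‖ₑ := hu.enorm
  have hG := measurable_resolventKernel l
  have hGp : Measurable fun p : R3 × R3 => resolventKernel l (p.1 - p.2) := hG.comp (by fun_prop)
  have hF : Measurable fun p : R3 × R3 =>
      W p.1 * ‖u p.1‖ₑ ^ 2 * (W p.2 * resolventKernel l (p.1 - p.2)) := by
    have h1 : Measurable fun p : R3 × R3 => ‖u p.1‖ₑ := hue.comp measurable_fst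
    fun_prop
  have hone : ∫⁻ x, ∫⁻ y, W x * ‖u x‖ₑ ^ 2 * (W y * resolventKernel l (x - y)) ≤
      M * ∫⁻ x, W x * ‖u x‖ₑ ^ 2 := by
    rw [← lintegral_const_mul _ (by fun_prop)]
    apply lintegral_mono
    intro x
    dsimp only
    have hGx : Measurable fun y => W y * resolventKernel l (x - y) :=
      hW.mul (hG.comp (measurable_const.sub measurable_id))
    rw [lintegral_const_mul _ hGx, mul_comm]
    gcongr
    exact hM x
  have hpt : ∀ x y, W x * ‖u x‖ₑ * (W y * ‖u y‖ₑ * resolventKernel l (x - y)) ≤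
      W x * ‖u x‖ₑ ^ 2 * (W y * resolventKernel l (x - y)) +
      W y * ‖u y‖ₑ ^ 2 * (W x * resolventKernel l (y - x)) := by
    intro x y
    have h1 : ‖u x‖ₑ * ‖u y‖ₑ ≤ ‖u x‖ₑ ^ 2 + ‖u y‖ₑ ^ 2 := by
      rcases le_total ‖u x‖ₑ ‖u y‖ₑ with h | h
      · calc _ ≤ ‖u y‖ₑ * ‖u y‖ₑ := by gcongr
          _ ≤ _ := by rw [← sq]; exact le_add_self
      · calc _ ≤ ‖u x‖ₑ * ‖u x‖ₑ := by gcongr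
          _ ≤ _ := by rw [← sq]; exact le_self_add
    calc _ = W x * W y * resolventKernel l (x - y) * (‖u x‖ₑ * ‖u y‖ₑ) := by ring
      _ ≤ W x * W y * resolventKernel l (x - y) * (‖u x‖ₑ ^ 2 + ‖u y‖ₑ ^ 2) := by gcongr
      _ = _ := by rw [← neg_sub x y, resolventKernel_neg]; ring
  calc _ ≤ ∫⁻ x, ∫⁻ y, (W x * ‖u x‖ₑ ^ 2 * (W y * resolventKernel l (x - y)) +
        W y * ‖u y‖ₑ ^ 2 * (W x * resolventKernel l (y - x))) :=
        lintegral_mono fun x => lintegral_mono fun y => hpt x y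
    _ = (∫⁻ x, ∫⁻ y, W x * ‖u x‖ₑ ^ 2 * (W y * resolventKernel l (x - y))) +
        ∫⁻ x, ∫⁻ y, W y * ‖u y‖ₑ ^ 2 * (W x * resolventKernel l (y - x)) := by
        rw [← lintegral_add_left hF.lintegral_prod_right']
        apply lintegral_congr
        intro x
        exact lintegral_add_left (hF.comp (by fun_prop : Measurable fun y : R3 => (x, y))) _
    _ ≤ M * (∫⁻ x, W x * ‖u x‖ₑ ^ 2) + M * ∫⁻ x, W x * ‖u x‖ₑ ^ 2 := by
        refine add_le_add hone ?_
        rw [lintegral_lintegral_swap]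
        · exact hone
        · exact (hF.comp measurable_swap).aemeasurable
    _ = _ := by ring

/-- Cauchy-Schwarz, squared. -/
lemma sq_lintegral_mul_le {f g : R3 → ℝ≥0∞} (hf : AEMeasurable f) (hg : AEMeasurable g) :
    (∫⁻ x, f x * g x) ^ 2 ≤ (∫⁻ x, f x ^ 2) * ∫⁻ x, g x ^ 2 := by
  have h := ENNReal.lintegral_mul_le_Lp_mul_Lq volume Real.HolderConjugate.two_two hf hg
  simp only [Pi.mul_apply, ENNReal.rpow_two] at h
  calc _ ≤ ((∫⁻ x, f x ^ 2) ^ (1 / 2 : ℝ) * (∫⁻ x, g x ^ 2) ^ (1 / 2 : ℝ)) ^ 2 := by gcongr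
    _ = _ := by
      rw [mul_pow, ← ENNReal.rpow_mul_natCast, ← ENNReal.rpow_mul_natCast]
      norm_num

lemma lintegral_enorm_sq (u : L2) : ∫⁻ x, ‖u x‖ₑ ^ 2 = ‖u‖ₑ ^ 2 := by
  have h := eLpNorm_nnreal_pow_eq_lintegral (μ := volume) (f := (u : R3 → ℂ)) (p := 2) (by norm_num)
  rw [Lp.enorm_def]
  simp only [NNReal.coe_ofNat, ENNReal.rpow_two, ENNReal.coe_ofNat] at h
  exact h.symm

/-- Duality between the `H¹` energy of `u` and the `H⁻¹` energy of `w u`, for a bounded weight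
`w`. -/
lemma lintegral_weight_sq_le_of_bounded {w : R3 → ℝ} (hw : Measurable w) (hw0 : ∀ x, 0 ≤ w x)
    {c : ℝ} (hwc : ∀ x, w x ≤ c) (hw2 : MemLp w 2) {l : ℝ} (hl : 0 < l) {M : ℝ≥0∞}
    (hM : ∀ x, ∫⁻ y, ‖w y‖ₑ * resolventKernel l (x - y) ≤ M) (u : L2) :
    ∫⁻ x, ‖w x‖ₑ * ‖u x‖ₑ ^ 2 ≤
      2 * M * ∫⁻ ξ, ENNReal.ofReal (4 * π ^ 2 * ‖ξ‖ ^ 2 + l) * ‖(𝓕 u : L2) ξ‖ₑ ^ 2 := by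
  set A := ∫⁻ x, ‖w x‖ₑ * ‖u x‖ₑ ^ 2 with hA
  set E := ∫⁻ ξ, ENNReal.ofReal (4 * π ^ 2 * ‖ξ‖ ^ 2 + l) * ‖(𝓕 u : L2) ξ‖ₑ ^ 2 with hE
  have hum : StronglyMeasurable u := Lp.stronglyMeasurable u
  have hum' : Measurable u := hum.measurable
  set f : R3 → ℂ := fun x => (w x : ℂ) * u x with hf
  have hfm : StronglyMeasurable f := (by fun_prop : Measurable f).stronglyMeasurable
  have hwe : ∀ x, ‖w x‖ₑ ≤ ENNReal.ofReal c := fun x => by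
    rw [Real.enorm_of_nonneg (hw0 x)]; exact ENNReal.ofReal_le_ofReal (hwc x)
  have hwb : MemLp w ∞ := memLp_top_of_bound hw.aestronglyMeasurable c
    (ae_of_all _ fun x => by rw [Real.norm_of_nonneg (hw0 x)]; exact hwc x)
  have hf1 : Integrable f := MemLp.integrable_mul hw2.ofReal (Lp.memLp u)
  have hf2 : MemLp f 2 := MemLp.mul (Lp.memLp u) hwb.ofReal
  have hAt : A ≠ ∞ := by
    refine ne_top_of_le_ne_top (b := ENNReal.ofReal c * ‖u‖ₑ ^ 2) (by finiteness) ?_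
    rw [← lintegral_enorm_sq, ← lintegral_const_mul' _ _ (by simp)]
    apply lintegral_mono
    intro x
    exact mul_le_mul_left (hwe x) _
  have hin : inner ℂ u (hf2.toLp f) = ∫ x, ((w x * ‖u x‖ ^ 2 : ℝ) : ℂ) := by
    rw [inner_eq_integral]
    apply integral_congr_ae
    filter_upwards [hf2.coeFn_toLp] with x hx
    rw [hx, hf]
    simp only
    rw [mul_left_comm, Complex.conj_mul']
    push_cast; rfl
  have hAe : A = ‖inner ℂ u (hf2.toLp f)‖ₑ := by
    have h1 : ∀ x, ‖w x‖ₑ * ‖u x‖ₑ ^ 2 = ENNReal.ofReal (w x * ‖u x‖ ^ 2) := by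
      intro x
      rw [Real.enorm_of_nonneg (hw0 x), ENNReal.ofReal_mul (hw0 x),
        ENNReal.ofReal_pow (norm_nonneg _), ofReal_norm]
    have h0 : ∀ x, 0 ≤ w x * ‖u x‖ ^ 2 := fun x => mul_nonneg (hw0 x) (by positivity)
    rw [hin, integral_complex_ofReal, ← ofReal_norm, Complex.norm_real,
      Real.norm_of_nonneg (integral_nonneg h0), ofReal_integral_eq_lintegral_ofReal _
      (ae_of_all _ h0), hA]
    · simp_rw [h1]
    · refine ⟨(by fun_prop : Measurable _).aestronglyMeasurable, ?_⟩
      rw [hasFiniteIntegral_iff_ofReal (ae_of_all _ h0)]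
      simp_rw [← h1]
      exact hAt.lt_top
  have hF : ∫⁻ ξ, ‖𝓕 f ξ‖ₑ ^ 2 * (ENNReal.ofReal (4 * π ^ 2 * ‖ξ‖ ^ 2 + l))⁻¹ ≤ 2 * M * A := by
    refine (lintegral_fourier_sq_div_le hf1 hfm hl).trans ?_
    have := lintegral_kernel_le (W := fun x => ‖w x‖ₑ) hw.enorm hum' hM
    have hfe : ∀ x, ‖f x‖ₑ = ‖w x‖ₑ * ‖u x‖ₑ := fun x => by
      rw [hf, enorm_mul, ← ofReal_norm (w x : ℂ), Complex.norm_real, ofReal_norm]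
    simp_rw [hfe]
    exact this
  have hfour : A ≤ ∫⁻ ξ, ‖(𝓕 u : L2) ξ‖ₑ * ‖𝓕 f ξ‖ₑ := by
    rw [hAe, ← Lp.inner_fourier_eq, inner_eq_integral]
    refine (enorm_integral_le_lintegral_enorm _).trans (le_of_eq (lintegral_congr_ae ?_))
    filter_upwards [coe_fourier_toLp hf1 hf2] with ξ hξ
    rw [hξ, enorm_mul, RCLike.enorm_conj]
  have hsq : A ^ 2 ≤ E * (2 * M * A) := by
    have hs : ∀ ξ : R3, 0 < 4 * π ^ 2 * ‖ξ‖ ^ 2 + l := fun ξ => by positivity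
    set s : R3 → ℝ≥0∞ := fun ξ => ENNReal.ofReal (4 * π ^ 2 * ‖ξ‖ ^ 2 + l) ^ (1 / 2 : ℝ) with hsdef
    have hs2 : ∀ ξ, s ξ ^ 2 = ENNReal.ofReal (4 * π ^ 2 * ‖ξ‖ ^ 2 + l) := by
      intro ξ
      rw [hsdef, ← ENNReal.rpow_mul_natCast]; norm_num
    have hs0 : ∀ ξ, s ξ ≠ 0 := fun ξ h => by
      have := hs2 ξ
      rw [h, zero_pow two_ne_zero, eq_comm, ENNReal.ofReal_eq_zero] at this
      exact absurd (hs ξ) (not_lt.mpr this)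
    have hst : ∀ ξ, s ξ ≠ ∞ := fun ξ h => by
      have := hs2 ξ
      rw [h] at this
      simp at this
    have hsm : Measurable s := by fun_prop
    have hc := continuous_fourier_of_integrable hf1
    have hum2 : Measurable (𝓕 u : L2) := (Lp.stronglyMeasurable _).measurable
    calc A ^ 2 ≤ (∫⁻ ξ, (s ξ * ‖(𝓕 u : L2) ξ‖ₑ) * ((s ξ)⁻¹ * ‖𝓕 f ξ‖ₑ)) ^ 2 := by
          gcongr
          refine hfour.trans (le_of_eq (lintegral_congr fun ξ => ?_))
          rw [mul_mul_mul_comm, ENNReal.mul_inv_cancel (hs0 ξ) (hst ξ), one_mul]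
      _ ≤ (∫⁻ ξ, (s ξ * ‖(𝓕 u : L2) ξ‖ₑ) ^ 2) * ∫⁻ ξ, ((s ξ)⁻¹ * ‖𝓕 f ξ‖ₑ) ^ 2 :=
          sq_lintegral_mul_le (hsm.mul hum2.enorm).aemeasurable
            (hsm.inv.mul hc.measurable.enorm).aemeasurable
      _ = E * ∫⁻ ξ, ‖𝓕 f ξ‖ₑ ^ 2 * (ENNReal.ofReal (4 * π ^ 2 * ‖ξ‖ ^ 2 + l))⁻¹ := by
          rw [hE]
          congr 1 <;> refine lintegral_congr fun ξ => ?_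
          · rw [mul_pow, hs2]
          · rw [mul_pow, ← ENNReal.inv_pow, hs2, mul_comm]
      _ ≤ _ := by gcongr
  rcases eq_or_ne A 0 with h0 | h0
  · rw [h0]; exact zero_le
  · have : A * A ≤ A * (2 * M * E) := by
      rw [← sq]; refine hsq.trans (le_of_eq (by ring))
    exact (ENNReal.mul_le_mul_iff_right h0 hAt).mp this

lemma lintegral_weight_sq_le {V : R3 → ℝ} (hV : AEMeasurable V) {l : ℝ} (hl : 0 < l) {M : ℝ≥0∞}
    (hM : ∀ x, ∫⁻ y, ‖V y‖ₑ * resolventKernel l (x - y) ≤ M) (u : L2) :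
    ∫⁻ x, ‖V x‖ₑ * ‖u x‖ₑ ^ 2 ≤
      2 * M * ∫⁻ ξ, ENNReal.ofReal (4 * π ^ 2 * ‖ξ‖ ^ 2 + l) * ‖(𝓕 u : L2) ξ‖ₑ ^ 2 := by
  wlog hVm : Measurable V generalizing V
  · have hae := hV.ae_eq_mk
    have h1 := this (V := hV.mk V) hV.measurable_mk.aemeasurable (fun x => ?_) hV.measurable_mk
    · refine le_trans (le_of_eq (lintegral_congr_ae ?_)) h1
      filter_upwards [hae] with x hx using by rw [hx]
    · refine le_trans (le_of_eq (lintegral_congr_ae ?_)) (hM x)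
      filter_upwards [hae] with x hx using by rw [hx]
  have hum : Measurable u := (Lp.stronglyMeasurable u).measurable
  set w : ℕ → R3 → ℝ := fun n => (Metric.closedBall 0 n).indicator fun x => min ‖V x‖ n with hw
  have hw0 : ∀ n x, 0 ≤ w n x := fun n x => indicator_nonneg (fun x _ => by positivity) x
  have hwle : ∀ n x, w n x ≤ min ‖V x‖ n := fun n x =>
    indicator_le_self' (fun x _ => by positivity) x
  have hwm : ∀ n, Measurable (w n) := fun n =>
    Measurable.indicator (by fun_prop) measurableSet_closedBall
  have hw2 : ∀ n, MemLp (w n) 2 := by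
    intro n
    rw [hw, memLp_indicator_iff_restrict measurableSet_closedBall]
    have : IsFiniteMeasure ((volume : Measure R3).restrict (Metric.closedBall 0 (n : ℝ))) :=
      ⟨by rw [Measure.restrict_apply_univ]; exact measure_closedBall_lt_top⟩
    refine MemLp.of_bound (by fun_prop) n (ae_of_all _ fun x => ?_)
    rw [Real.norm_of_nonneg (by positivity)]
    exact min_le_right _ _
  have hwe : ∀ n x, ‖w n x‖ₑ ≤ ‖V x‖ₑ := by
    intro n x
    rw [Real.enorm_of_nonneg (hw0 n x), ← ofReal_norm]
    exact ENNReal.ofReal_le_ofReal ((hwle n x).trans (min_le_left _ _))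
  have hbound : ∀ n, ∫⁻ x, ‖w n x‖ₑ * ‖u x‖ₑ ^ 2 ≤ 2 * M *
      ∫⁻ ξ, ENNReal.ofReal (4 * π ^ 2 * ‖ξ‖ ^ 2 + l) * ‖(𝓕 u : L2) ξ‖ₑ ^ 2 := fun n =>
    lintegral_weight_sq_le_of_bounded (hwm n) (hw0 n)
      (fun x => (hwle n x).trans (min_le_right _ _)) (hw2 n) hl
      (fun x => (lintegral_mono fun y => mul_le_mul_left (hwe n y) _).trans (hM x)) u
  have hev : ∀ x, ∀ᶠ n : ℕ in atTop, ‖V x‖ₑ * ‖u x‖ₑ ^ 2 = ‖w n x‖ₑ * ‖u x‖ₑ ^ 2 := by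
    intro x
    filter_upwards [eventually_ge_atTop ⌈max ‖x‖ ‖V x‖⌉₊] with n hn
    have hn' : max ‖x‖ ‖V x‖ ≤ n := Nat.ceil_le.mp hn
    have hmem : x ∈ Metric.closedBall (0 : R3) n := by
      simpa using (le_max_left _ _).trans hn'
    rw [hw]
    simp only [indicator_of_mem hmem]
    rw [min_eq_left ((le_max_right _ _).trans hn'), enorm_norm]
  calc ∫⁻ x, ‖V x‖ₑ * ‖u x‖ₑ ^ 2
      ≤ ∫⁻ x, liminf (fun n => ‖w n x‖ₑ * ‖u x‖ₑ ^ 2) atTop := by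
        apply lintegral_mono
        intro x
        have : Tendsto (fun n => ‖w n x‖ₑ * ‖u x‖ₑ ^ 2) atTop (𝓝 (‖V x‖ₑ * ‖u x‖ₑ ^ 2)) :=
          tendsto_const_nhds.congr' (hev x)
        exact this.liminf_eq.ge
    _ ≤ liminf (fun n => ∫⁻ x, ‖w n x‖ₑ * ‖u x‖ₑ ^ 2) atTop :=
        lintegral_liminf_le fun n => by
          have := hwm n
          fun_prop
    _ ≤ _ := liminf_le_of_le (h := fun b hb => by
        obtain ⟨n, hn⟩ := hb.exists
        exact hn.trans (hbound n))

/-- Kato class potentials are infinitesimally form bounded with respect to the Laplacian. -/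
theorem KatoClass.exists_form_bound {V : R3 → ℝ} (hV : KatoClass V) {ε : ℝ≥0∞} (hε : 0 < ε) :
    ∃ l : ℝ, 0 < l ∧ ∀ u : L2, ∫⁻ x, ‖V x‖ₑ * ‖u x‖ₑ ^ 2 ≤
      ε * ∫⁻ ξ, ENNReal.ofReal (4 * π ^ 2 * ‖ξ‖ ^ 2 + l) * ‖(𝓕 u : L2) ξ‖ₑ ^ 2 := by
  obtain ⟨l, hl, h⟩ := hV.exists_lintegral_resolventKernel_le (ENNReal.half_pos hε.ne')
  refine ⟨l, hl, fun u => ?_⟩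
  have := lintegral_weight_sq_le hV.1 hl h u
  rwa [ENNReal.mul_div_cancel (by simp) (by simp)] at this

lemma toDist_injective : Function.Injective toDist := by
  have h := Lp.ker_toTemperedDistributionCLM_eq_bot (E := R3) (F := ℂ) (μ := volume) (p := 2)
  exact LinearMap.ker_eq_bot.mp h

lemma toDist_add (u v : L2) : toDist (u + v) = toDist u + toDist v :=
  map_add (Lp.toTemperedDistributionCLM ℂ volume 2) u v

lemma toDist_sub (u v : L2) : toDist (u - v) = toDist u - toDist v :=
  map_sub (Lp.toTemperedDistributionCLM ℂ volume 2) u v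

lemma toDist_smul (c : ℂ) (u : L2) : toDist (c • u) = c • toDist u :=
  map_smul (Lp.toTemperedDistributionCLM ℂ volume 2) c u

lemma IsRegular.eq {w : R3 → ℂ} {T T' : 𝓢'(R3, ℂ)} (h : IsRegular w T) (h' : IsRegular w T') :
    T = T' := by
  ext φ
  rw [(h φ).2, (h' φ).2]

lemma IsRegular.isRegular_regular {w : R3 → ℂ} {T : 𝓢'(R3, ℂ)} (h : IsRegular w T) :
    IsRegular w (regular w) := by
  have h' : ∃ T, IsRegular w T := ⟨T, h⟩
  rw [regular, dif_pos h']
  exact h'.choose_spec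

lemma IsRegular.regular_eq {w : R3 → ℂ} {T : 𝓢'(R3, ℂ)} (h : IsRegular w T) : regular w = T :=
  h.isRegular_regular.eq h

/-! ### The gradient on the Fourier side -/

lemma HasGradient.coe_fourier {u : L2} {g : Fin 3 → L2} (h : HasGradient u g) (i : Fin 3) :
    ((𝓕 (g i) : L2) : R3 → ℂ) =ᵐ[volume] fun ξ => 2 * π * Complex.I * ξ i * (𝓕 u : L2) ξ := by
  have htg : (fun x : R3 => ((inner ℝ x (EuclideanSpace.single i (1 : ℝ)) : ℝ) : ℂ)).HasTemperateGrowth := by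
    fun_prop
  have hin : ∀ x : R3, inner ℝ x (EuclideanSpace.single i (1 : ℝ)) = x i := by
    intro x
    simp [EuclideanSpace.inner_single_right]
  apply ae_eq_of_forall_integral_schwartz_eq (locallyIntegrable_coe _)
  · have hc : Continuous fun ξ : R3 => 2 * (π : ℂ) * Complex.I * ξ i := by fun_prop
    exact (locallyIntegrable_coe (𝓕 u)).continuous_mul hc
  intro φ
  have h1 := congrArg (fun T : 𝓢'(R3, ℂ) => (𝓕 T) φ) (h i)
  simp only [TemperedDistribution.fourier_lineDerivOp_eq, toDist,
    Lp.fourier_toTemperedDistribution_eq] at h1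
  have h2 := toDist_apply (𝓕 (g i)) φ
  rw [toDist] at h2
  rw [← h2, ← h1]
  have h3 := toDist_apply (𝓕 u) (SchwartzMap.smulLeftCLM ℂ
    (fun x : R3 => ((inner ℝ x (EuclideanSpace.single i (1 : ℝ)) : ℝ) : ℂ)) φ)
  change (2 * (π : ℂ) * Complex.I) • (toDist (𝓕 u) (SchwartzMap.smulLeftCLM ℂ
    (fun x : R3 => ((inner ℝ x (EuclideanSpace.single i (1 : ℝ)) : ℝ) : ℂ)) φ)) = _
  rw [h3, smul_eq_mul, ← integral_const_mul]
  congr 1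
  ext x
  rw [SchwartzMap.smulLeftCLM_apply_apply htg, hin]
  simp only [smul_eq_mul]
  ring

/-- Plancherel's identity for the energy. -/
lemma HasGradient.energy_eq {u : L2} {g : Fin 3 → L2} (h : HasGradient u g) {l : ℝ} (hl : 0 ≤ l) :
    ∫⁻ ξ, ENNReal.ofReal (4 * π ^ 2 * ‖ξ‖ ^ 2 + l) * ‖(𝓕 u : L2) ξ‖ₑ ^ 2 =
      ENNReal.ofReal ((∑ i, ‖g i‖ ^ 2) + l * ‖u‖ ^ 2) := by
  have hm : Measurable (𝓕 u : L2) := (Lp.stronglyMeasurable _).measurable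
  have hplan : ∀ v : L2, ENNReal.ofReal (‖v‖ ^ 2) = ∫⁻ ξ, ‖(𝓕 v : L2) ξ‖ₑ ^ 2 := by
    intro v
    rw [lintegral_enorm_sq, ← ofReal_norm, Lp.norm_fourier_eq, ENNReal.ofReal_pow (norm_nonneg _)]
  have hg : ∀ i, ENNReal.ofReal (‖g i‖ ^ 2) =
      ∫⁻ ξ, ENNReal.ofReal (4 * π ^ 2 * ξ i ^ 2) * ‖(𝓕 u : L2) ξ‖ₑ ^ 2 := by
    intro i
    rw [hplan]
    apply lintegral_congr_ae
    filter_upwards [h.coe_fourier i] with ξ hξ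
    rw [hξ, enorm_mul, mul_pow]
    congr 1
    rw [← ofReal_norm, ← ENNReal.ofReal_pow (norm_nonneg _)]
    congr 1
    simp only [norm_mul, Complex.norm_ofNat, Complex.norm_real, Complex.norm_I, mul_pow,
      Real.norm_eq_abs, sq_abs]
    ring
  rw [ENNReal.ofReal_add (by positivity) (by positivity), ENNReal.ofReal_mul hl, hplan,
    ENNReal.ofReal_sum_of_nonneg (fun i _ => by positivity), Finset.sum_congr rfl fun i _ => hg i,
    ← lintegral_finsetSum _ (fun i _ => by fun_prop), ← lintegral_const_mul _ (by fun_prop),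
    ← lintegral_add_left (by fun_prop)]
  apply lintegral_congr
  intro ξ
  rw [← Finset.sum_mul, ← add_mul, ← ENNReal.ofReal_sum_of_nonneg (fun i _ => by positivity),
    ← ENNReal.ofReal_add (Finset.sum_nonneg fun i _ => by positivity) hl, ← Finset.mul_sum,
    EuclideanSpace.real_norm_sq_eq]

lemma exists_hasGradient {u : L2} (hu : u ∈ H1) : ∃ g, HasGradient u g := by
  have h : ∀ i : Fin 3, ∃ g : L2, ∂_{EuclideanSpace.single i (1 : ℝ)} (toDist u) = toDist g := by
    intro i
    have h1 := TemperedDistribution.MemSobolev.lineDerivOp (m := EuclideanSpace.single i (1 : ℝ)) hu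
    rw [sub_self, TemperedDistribution.memSobolev_zero_iff] at h1
    exact h1
  choose g hg using h
  exact ⟨g, hg⟩

/-- The form bound holds for all sufficiently large constants. -/
theorem KatoClass.exists_formBound {V : R3 → ℝ} (hV : KatoClass V) :
    ∃ a₀ : ℝ, ∀ a : ℝ, a₀ ≤ a → FormBound V a := by
  obtain ⟨l, hl, h⟩ := hV.exists_form_bound (ε := ENNReal.ofReal (1 / 2)) (by simp)
  refine ⟨l / 2, fun a ha u _ g hg => ?_⟩
  have hb := h u
  have hum : Measurable u := (Lp.stronglyMeasurable u).measurable
  rw [hg.energy_eq hl.le, ← ENNReal.ofReal_mul (by norm_num)] at hb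
  set N := 1 / 2 * ((∑ i, ‖g i‖ ^ 2) + l * ‖u‖ ^ 2) with hN
  have hN0 : 0 ≤ N := by positivity
  have he : ∀ x, ‖V x * ‖u x‖ ^ 2‖ₑ = ‖V x‖ₑ * ‖u x‖ₑ ^ 2 := by
    intro x
    rw [enorm_mul, enorm_pow, enorm_norm]
  have hint : Integrable (fun x => V x * ‖u x‖ ^ 2) := by
    refine ⟨(hV.1.mul (by fun_prop)).aestronglyMeasurable, ?_⟩
    rw [HasFiniteIntegral]
    simp_rw [he]
    exact hb.trans_lt ENNReal.ofReal_lt_top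
  have habs : |∫ x, V x * ‖u x‖ ^ 2| ≤ N := by
    have h1 : ‖∫ x, V x * ‖u x‖ ^ 2‖ₑ ≤ ENNReal.ofReal N := by
      refine (enorm_integral_le_lintegral_enorm _).trans ?_
      simp_rw [he]
      exact hb
    rw [← ofReal_norm, ENNReal.ofReal_le_ofReal_iff hN0] at h1
    exact h1
  have h2 := abs_le.mp habs
  have h3 : l / 2 * ‖u‖ ^ 2 ≤ a * ‖u‖ ^ 2 := by gcongr
  refine ⟨hint, ?_, ?_⟩
  · linarith [h2.1]
  · linarith [h2.2]

/-! ### Multiplication operators on the range of a bounded operator -/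

lemma eLpNorm_two_sq (f : R3 → ℂ) : eLpNorm f 2 volume ^ 2 = ∫⁻ x, ‖f x‖ₑ ^ 2 := by
  have h := eLpNorm_nnreal_pow_eq_lintegral (μ := volume) (f := f) (p := 2) (by norm_num)
  simpa only [NNReal.coe_ofNat, ENNReal.rpow_two, ENNReal.coe_ofNat] using h

lemma memLp_weight_mul {w : R3 → ℂ} (hw : AEStronglyMeasurable w) {R : L2 →L[ℂ] L2} {C : NNReal}
    (h : ∀ f, ∫⁻ x, ‖w x‖ₑ ^ 2 * ‖R f x‖ₑ ^ 2 ≤ (C : ℝ≥0∞) * ‖f‖ₑ ^ 2) (f : L2) :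
    MemLp (fun x => w x * R f x) 2 := by
  refine ⟨hw.mul (Lp.aestronglyMeasurable _), ?_⟩
  have h1 := eLpNorm_two_sq (fun x => w x * R f x)
  simp_rw [enorm_mul, mul_pow] at h1
  by_contra htop
  rw [not_lt, top_le_iff] at htop
  have h2 := h f
  rw [← h1, htop] at h2
  rw [ENNReal.top_pow two_ne_zero, top_le_iff] at h2
  have : (C : ℝ≥0∞) * ‖f‖ₑ ^ 2 ≠ ∞ := by finiteness
  exact this h2

/-- The bounded operator `f ↦ w • R f`, for a weight `w` that is form bounded on the range
of `R`. -/
def weightedOp (w : R3 → ℂ) (hw : AEStronglyMeasurable w) (R : L2 →L[ℂ] L2) (C : NNReal)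
    (h : ∀ f, ∫⁻ x, ‖w x‖ₑ ^ 2 * ‖R f x‖ₑ ^ 2 ≤ (C : ℝ≥0∞) * ‖f‖ₑ ^ 2) : L2 →L[ℂ] L2 :=
  LinearMap.mkContinuous
    { toFun := fun f => (memLp_weight_mul hw h f).toLp _
      map_add' := fun f g => by
        rw [← MemLp.toLp_add]
        apply MemLp.toLp_congr
        rw [map_add]
        filter_upwards [Lp.coeFn_add (R f) (R g)] with x hx
        rw [hx]
        simp only [Pi.add_apply]
        ring
      map_smul' := fun c f => by
        rw [← MemLp.toLp_const_smul]
        apply MemLp.toLp_congr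
        rw [map_smul]
        filter_upwards [Lp.coeFn_smul c (R f)] with x hx
        rw [hx]
        simp only [Pi.smul_apply, smul_eq_mul, RingHom.id_apply]
        ring }
    (Real.sqrt C) (fun f => by
      change ‖(memLp_weight_mul hw h f).toLp _‖ ≤ _
      rw [Lp.norm_toLp]
      apply ENNReal.toReal_le_of_le_ofReal (by positivity)
      have h1 := eLpNorm_two_sq (fun x => w x * R f x)
      simp_rw [enorm_mul, mul_pow] at h1
      have h2 := h f
      rw [← h1] at h2
      refine (ENNReal.pow_right_strictMono two_ne_zero).le_iff_le.mp (h2.trans (le_of_eq ?_))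
      rw [ENNReal.ofReal_mul (by positivity), mul_pow, ofReal_norm,
        ← ENNReal.ofReal_pow (by positivity), Real.sq_sqrt C.coe_nonneg, ENNReal.ofReal_coe_nnreal])

lemma coe_weightedOp (w : R3 → ℂ) (hw : AEStronglyMeasurable w) (R : L2 →L[ℂ] L2) (C : NNReal)
    (h : ∀ f, ∫⁻ x, ‖w x‖ₑ ^ 2 * ‖R f x‖ₑ ^ 2 ≤ (C : ℝ≥0∞) * ‖f‖ₑ ^ 2) (f : L2) :
    (weightedOp w hw R C h f : R3 → ℂ) =ᵐ[volume] fun x => w x * R f x :=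
  (memLp_weight_mul hw h f).coeFn_toLp

/-! ### The Bessel potential on `L²` -/

/-- The symbol `(1 + |ξ|²)^{-1/2}`. -/
def besselSymbol (ξ : R3) : ℂ := (((1 + ‖ξ‖ ^ 2) ^ ((-1 : ℝ) / 2) : ℝ) : ℂ)

lemma continuous_besselSymbol : Continuous besselSymbol := by
  unfold besselSymbol
  have : ∀ ξ : R3, 1 + ‖ξ‖ ^ 2 ≠ 0 := fun ξ => by positivity
  apply Complex.continuous_ofReal.comp
  apply Continuous.rpow_const (by fun_prop)
  intro ξ
  exact Or.inl (this ξ)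

lemma enorm_besselSymbol_sq (ξ : R3) :
    ‖besselSymbol ξ‖ₑ ^ 2 = ENNReal.ofReal ((1 + ‖ξ‖ ^ 2)⁻¹) := by
  have h0 : (0 : ℝ) < 1 + ‖ξ‖ ^ 2 := by positivity
  rw [← ofReal_norm, besselSymbol, Complex.norm_real, Real.norm_of_nonneg (by positivity),
    ← ENNReal.ofReal_pow (by positivity), ← Real.rpow_mul_natCast h0.le]
  congr 1
  rw [← Real.rpow_neg_one]
  norm_num

lemma lintegral_besselSymbol_le (f : L2) :
    ∫⁻ x, ‖besselSymbol x‖ₑ ^ 2 * ‖ContinuousLinearMap.id ℂ L2 f x‖ₑ ^ 2 ≤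
      ((1 : NNReal) : ℝ≥0∞) * ‖f‖ₑ ^ 2 := by
  rw [ENNReal.coe_one, one_mul, ← lintegral_enorm_sq]
  apply lintegral_mono
  intro x
  have h1 : ‖besselSymbol x‖ₑ ^ 2 ≤ 1 := by
    rw [enorm_besselSymbol_sq, ENNReal.ofReal_le_one]
    apply inv_le_one_of_one_le₀
    nlinarith [sq_nonneg ‖x‖]
  calc _ ≤ 1 * ‖f x‖ₑ ^ 2 := mul_le_mul_left h1 _
    _ = _ := one_mul _

/-- The Fourier multiplier `(1 + |ξ|²)^{-1/2}` on `L²(ℝ³)`, with range `H¹(ℝ³)`. -/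
def besselOp : L2 →L[ℂ] L2 :=
  fourierInvCLM ℂ L2 ∘L weightedOp besselSymbol continuous_besselSymbol.aestronglyMeasurable
    (ContinuousLinearMap.id ℂ L2) 1 lintegral_besselSymbol_le ∘L fourierCLM ℂ L2

lemma fourier_besselOp (f : L2) : 𝓕 (besselOp f) =
    weightedOp besselSymbol continuous_besselSymbol.aestronglyMeasurable
    (ContinuousLinearMap.id ℂ L2) 1 lintegral_besselSymbol_le (𝓕 f) :=
  fourier_fourierInv_eq _

lemma coe_fourier_besselOp (f : L2) : ((𝓕 (besselOp f) : L2) : R3 → ℂ) =ᵐ[volume]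
    fun ξ => besselSymbol ξ * (𝓕 f : L2) ξ := by
  rw [fourier_besselOp]
  exact coe_weightedOp _ _ _ _ _ _

lemma toDist_besselOp (f : L2) :
    toDist (besselOp f) = TemperedDistribution.besselPotential R3 ℂ (-1) (toDist f) := by
  have h0 : besselSymbol.HasTemperateGrowth := by unfold besselSymbol; fun_prop
  have h1 : 𝓕 (toDist (besselOp f)) =
      𝓕 (TemperedDistribution.besselPotential R3 ℂ (-1) (toDist f)) := by
    rw [TemperedDistribution.fourier_besselPotential_eq_smulLeftCLM_fourier_apply, toDist, toDist,
      Lp.fourier_toTemperedDistribution_eq, Lp.fourier_toTemperedDistribution_eq]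
    ext φ
    change toDist _ φ = toDist (𝓕 f) (SchwartzMap.smulLeftCLM ℂ besselSymbol φ)
    rw [toDist_apply, toDist_apply]
    apply integral_congr_ae
    filter_upwards [coe_fourier_besselOp f] with ξ hξ
    rw [hξ, SchwartzMap.smulLeftCLM_apply_apply h0, smul_eq_mul]
    ring
  calc toDist (besselOp f) = 𝓕⁻ (𝓕 (toDist (besselOp f)) : 𝓢'(R3, ℂ)) :=
        (fourierInv_fourier_eq _).symm
    _ = 𝓕⁻ (𝓕 (TemperedDistribution.besselPotential R3 ℂ (-1) (toDist f)) : 𝓢'(R3, ℂ)) := by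
        rw [h1]
    _ = _ := fourierInv_fourier_eq _

lemma mem_H1_iff {u : L2} : u ∈ H1 ↔ ∃ h, u = besselOp h := by
  constructor
  · rintro ⟨h, hh⟩
    refine ⟨h, toDist_injective ?_⟩
    rw [toDist_besselOp]
    exact ((TemperedDistribution.besselPotential_neg_apply_eq_iff _ _ _).mpr hh).symm
  · rintro ⟨h, rfl⟩
    refine ⟨h, ?_⟩
    rw [toDist_besselOp]
    exact (TemperedDistribution.besselPotential_neg_apply_eq_iff _ _ _).mp rfl

lemma besselOp_mem_H1 (h : L2) : besselOp h ∈ H1 := mem_H1_iff.mpr ⟨h, rfl⟩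

lemma mem_Hneg1_iff {T : 𝓢'(R3, ℂ)} :
    T ∈ Hneg1 ↔ ∃ h, T = TemperedDistribution.besselPotential R3 ℂ 1 (toDist h) := by
  constructor
  · rintro ⟨h, hh⟩
    exact ⟨h, ((TemperedDistribution.besselPotential_neg_apply_eq_iff _ _ _).mp hh).symm⟩
  · rintro ⟨h, hh⟩
    exact ⟨h, (TemperedDistribution.besselPotential_neg_apply_eq_iff _ _ _).mpr hh.symm⟩

lemma inner_besselOp (f g : L2) : inner ℂ (besselOp f) g = inner ℂ f (besselOp g) := by
  rw [← Lp.inner_fourier_eq, ← Lp.inner_fourier_eq f, inner_eq_integral, inner_eq_integral]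
  apply integral_congr_ae
  filter_upwards [coe_fourier_besselOp f, coe_fourier_besselOp g] with ξ h1 h2
  rw [h1, h2, map_mul]
  have : conj (besselSymbol ξ) = besselSymbol ξ := by
    rw [besselSymbol, Complex.conj_ofReal]
  rw [this]
  ring

/-- The energy with mass `4π²` of `besselOp h` is a multiple of the `L²` norm of `h`. -/
lemma energy_besselOp (h : L2) :
    ∫⁻ ξ, ENNReal.ofReal (4 * π ^ 2 * ‖ξ‖ ^ 2 + 4 * π ^ 2) * ‖(𝓕 (besselOp h) : L2) ξ‖ₑ ^ 2 =
      ENNReal.ofReal (4 * π ^ 2 * ‖h‖ ^ 2) := by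
  have h1 : ENNReal.ofReal (‖h‖ ^ 2) = ∫⁻ ξ, ‖(𝓕 h : L2) ξ‖ₑ ^ 2 := by
    rw [lintegral_enorm_sq, ← ofReal_norm, Lp.norm_fourier_eq, ENNReal.ofReal_pow (norm_nonneg _)]
  rw [ENNReal.ofReal_mul (by positivity), h1, ← lintegral_const_mul' _ _ ENNReal.ofReal_ne_top]
  apply lintegral_congr_ae
  filter_upwards [coe_fourier_besselOp h] with ξ hξ
  have h0 : (0 : ℝ) < 1 + ‖ξ‖ ^ 2 := by positivity
  rw [hξ, enorm_mul, mul_pow, enorm_besselSymbol_sq, ← mul_assoc, ← ENNReal.ofReal_mul (by positivity)]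
  congr 2
  field_simp
  ring

lemma HasGradient.sum_norm_sq_add {h : L2} {g : Fin 3 → L2} (hg : HasGradient (besselOp h) g) :
    (∑ i, ‖g i‖ ^ 2) + 4 * π ^ 2 * ‖besselOp h‖ ^ 2 = 4 * π ^ 2 * ‖h‖ ^ 2 := by
  have h1 := hg.energy_eq (l := 4 * π ^ 2) (by positivity)
  rw [energy_besselOp, ENNReal.ofReal_eq_ofReal_iff (by positivity) (by positivity)] at h1
  exact h1.symm

lemma norm_besselOp_le (h : L2) : ‖besselOp h‖ ≤ ‖h‖ := by
  obtain ⟨g, hg⟩ := exists_hasGradient (besselOp_mem_H1 h)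
  have h1 := hg.sum_norm_sq_add
  have h2 : 0 ≤ ∑ i, ‖g i‖ ^ 2 := by positivity
  refine le_of_sq_le_sq (le_of_mul_le_mul_left ?_ (by positivity : 0 < 4 * π ^ 2)) (norm_nonneg _)
  linarith

lemma fourier_star_toLp (φ : 𝓢(R3, ℂ)) :
    (𝓕 (star (φ.toLp 2) : L2) : L2) = star ((𝓕⁻ φ).toLp 2) := by
  have hi : Integrable (fun x => conj (φ x)) :=
    (Complex.conjLIE.toContinuousLinearEquiv.integrable_comp_iff).mpr φ.integrable
  have h2 : MemLp (fun x => conj (φ x)) 2 :=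
    (φ.memLp 2 volume).star
  have hs : (star (φ.toLp 2) : L2) = h2.toLp _ := by
    apply Lp.ext
    filter_upwards [Lp.coeFn_star (φ.toLp 2 : L2), h2.coeFn_toLp, φ.coeFn_toLp 2] with x h3 h4 h5
    rw [h3, h4, Pi.star_apply, h5]
    rfl
  rw [hs]
  apply Lp.ext
  filter_upwards [coe_fourier_toLp hi h2, Lp.coeFn_star ((𝓕⁻ φ).toLp 2 : L2),
    (𝓕⁻ φ).coeFn_toLp 2] with x h3 h4 h5
  rw [h3, h4, Pi.star_apply, h5, SchwartzMap.fourierInv_coe, Real.fourier_eq', Real.fourierInv_eq',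
    RCLike.star_def, ← integral_conj]
  congr 1
  ext y
  rw [smul_eq_mul, smul_eq_mul, map_mul, ← Complex.exp_conj]
  congr 2
  rw [map_mul, Complex.conj_ofReal, Complex.conj_I]
  push_cast
  ring

/-- The transpose of the Bessel potential of order one, composed with conjugation, is inverted by
`besselOp`. -/
lemma besselOp_star_toLp (φ : 𝓢(R3, ℂ)) :
    besselOp (star ((𝓕 (SchwartzMap.smulLeftCLM ℂ
      (fun x : R3 => (((1 + ‖x‖ ^ 2) ^ ((1 : ℝ) / 2) : ℝ) : ℂ)) (𝓕⁻ φ))).toLp 2)) =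
    star (φ.toLp 2) := by
  have htg : (fun x : R3 => (((1 + ‖x‖ ^ 2) ^ ((1 : ℝ) / 2) : ℝ) : ℂ)).HasTemperateGrowth := by
    fun_prop
  set χ := SchwartzMap.smulLeftCLM ℂ
      (fun x : R3 => (((1 + ‖x‖ ^ 2) ^ ((1 : ℝ) / 2) : ℝ) : ℂ)) (𝓕⁻ φ) with hχ
  apply (Lp.fourierTransformₗᵢ R3 ℂ).injective
  change (𝓕 (besselOp _) : L2) = 𝓕 (star (φ.toLp 2) : L2)
  rw [fourier_star_toLp]
  apply Lp.ext
  have h1 := coe_fourier_besselOp (star ((𝓕 χ).toLp 2))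
  rw [fourier_star_toLp, fourierInv_fourier_eq] at h1
  filter_upwards [h1, Lp.coeFn_star (χ.toLp 2 : L2), χ.coeFn_toLp 2,
    Lp.coeFn_star ((𝓕⁻ φ).toLp 2 : L2), (𝓕⁻ φ).coeFn_toLp 2] with x h2 h3 h4 h5 h6
  rw [h2, h3, h5, Pi.star_apply, Pi.star_apply, h4, h6, hχ,
    SchwartzMap.smulLeftCLM_apply_apply htg, smul_eq_mul, RCLike.star_def, map_mul,
    Complex.conj_ofReal, besselSymbol, ← mul_assoc, ← Complex.ofReal_mul,
    ← Real.rpow_add (by positivity)]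
  norm_num

/-! ### The potential as a bounded form on `H¹` -/

lemma KatoClass.exists_lintegral_besselOp_le {V : R3 → ℝ} (hV : KatoClass V) :
    ∃ C : NNReal, ∀ h : L2, ∫⁻ x, ‖V x‖ₑ * ‖besselOp h x‖ₑ ^ 2 ≤ (C : ℝ≥0∞) * ‖h‖ₑ ^ 2 := by
  obtain ⟨l, hl, hb⟩ := hV.exists_form_bound (ε := 1) one_pos
  refine ⟨(4 * π ^ 2 + l).toNNReal, fun h => ?_⟩
  obtain ⟨g, hg⟩ := exists_hasGradient (besselOp_mem_H1 h)
  refine (hb (besselOp h)).trans ?_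
  rw [one_mul, hg.energy_eq hl.le, ← ofReal_norm, ← ENNReal.ofReal_pow (norm_nonneg _),
    ← ENNReal.ofReal, ← ENNReal.ofReal_mul (by positivity)]
  apply ENNReal.ofReal_le_ofReal
  have h1 := hg.sum_norm_sq_add
  have h2 : 4 * π ^ 2 * ‖besselOp h‖ ^ 2 ≥ 0 := by positivity
  have h3 : l * ‖besselOp h‖ ^ 2 ≤ l * ‖h‖ ^ 2 := by
    gcongr
    exact norm_besselOp_le h
  linarith

lemma enorm_sqrt_sq (v : ℝ) : ‖((√|v| : ℝ) : ℂ)‖ₑ ^ 2 = ‖v‖ₑ := by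
  rw [← ofReal_norm, Complex.norm_real, ← ENNReal.ofReal_pow (norm_nonneg _), Real.norm_eq_abs,
    sq_abs, Real.sq_sqrt (abs_nonneg _), ← Real.norm_eq_abs, ofReal_norm]

lemma enorm_div_sqrt_sq (v : ℝ) : ‖((v / √|v| : ℝ) : ℂ)‖ₑ ^ 2 = ‖v‖ₑ := by
  rw [← ofReal_norm, Complex.norm_real, ← ENNReal.ofReal_pow (norm_nonneg _), Real.norm_eq_abs,
    sq_abs, div_pow, Real.sq_sqrt (abs_nonneg _), ← sq_abs, sq, mul_self_div_self,
    ← Real.norm_eq_abs, ofReal_norm]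

lemma sqrt_mul_div_sqrt (v : ℝ) : √|v| * (v / √|v|) = v := by
  rcases eq_or_ne v 0 with rfl | hv
  · simp
  · have : √|v| ≠ 0 := by positivity
    field_simp

lemma integrable_conj_mul (u v : L2) : Integrable (fun x => conj (u x) * v x) := by
  simpa [RCLike.inner_apply, mul_comm] using L2.integrable_inner (𝕜 := ℂ) u v

/-- The form `∫ V ū v` on `H¹`, transported to `L²` by `besselOp`, is given by a bounded operator,
and this operator represents multiplication by `V`. -/
theorem KatoClass.exists_potentialOp {V : R3 → ℝ} (hV : KatoClass V) :
    ∃ Q : L2 →L[ℂ] L2,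
      (∀ h k, inner ℂ h (Q k) = ∫ x, (V x : ℂ) * (conj (besselOp h x) * besselOp k x)) ∧
      (∀ h k, inner ℂ (Q h) k = inner ℂ h (Q k)) ∧
      ∀ h, IsRegular (potential V (besselOp h))
        (TemperedDistribution.besselPotential R3 ℂ 1 (toDist (Q h))) := by
  obtain ⟨C, hC⟩ := hV.exists_lintegral_besselOp_le
  have hVm := hV.1
  have hw₁ : AEStronglyMeasurable (fun x => ((√|V x| : ℝ) : ℂ)) :=
    (Complex.measurable_ofReal.comp_aemeasurable
      ((continuous_abs.measurable.comp_aemeasurable hVm).sqrt)).aestronglyMeasurable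
  have hw₂ : AEStronglyMeasurable (fun x => ((V x / √|V x| : ℝ) : ℂ)) :=
    (Complex.measurable_ofReal.comp_aemeasurable
      (hVm.div (continuous_abs.measurable.comp_aemeasurable hVm).sqrt)).aestronglyMeasurable
  have hC₁ : ∀ f, ∫⁻ x, ‖((√|V x| : ℝ) : ℂ)‖ₑ ^ 2 * ‖besselOp f x‖ₑ ^ 2 ≤
      (C : ℝ≥0∞) * ‖f‖ₑ ^ 2 := fun f => by
    simp_rw [enorm_sqrt_sq]; exact hC f
  have hC₂ : ∀ f, ∫⁻ x, ‖((V x / √|V x| : ℝ) : ℂ)‖ₑ ^ 2 * ‖besselOp f x‖ₑ ^ 2 ≤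
      (C : ℝ≥0∞) * ‖f‖ₑ ^ 2 := fun f => by
    simp_rw [enorm_div_sqrt_sq]; exact hC f
  set T₁ := weightedOp _ hw₁ besselOp C hC₁ with hT₁
  set T₂ := weightedOp _ hw₂ besselOp C hC₂ with hT₂
  have hpt : ∀ (v : ℝ) (z z' : ℂ), conj (((√|v| : ℝ) : ℂ) * z) * (((v / √|v| : ℝ) : ℂ) * z') =
      (v : ℂ) * (conj z * z') := by
    intro v z z'
    rw [map_mul, Complex.conj_ofReal]
    calc _ = ((√|v| * (v / √|v|) : ℝ) : ℂ) * (conj z * z') := by push_cast; ring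
      _ = _ := by rw [sqrt_mul_div_sqrt]
  have hpt' : ∀ (v : ℝ) (z z' : ℂ), conj (((v / √|v| : ℝ) : ℂ) * z) * (((√|v| : ℝ) : ℂ) * z') =
      (v : ℂ) * (conj z * z') := by
    intro v z z'
    rw [map_mul, Complex.conj_ofReal]
    calc _ = ((√|v| * (v / √|v|) : ℝ) : ℂ) * (conj z * z') := by push_cast; ring
      _ = _ := by rw [sqrt_mul_div_sqrt]
  have h₁₂ : ∀ h k, inner ℂ (T₁ h) (T₂ k) =
      ∫ x, (V x : ℂ) * (conj (besselOp h x) * besselOp k x) := by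
    intro h k
    rw [inner_eq_integral]
    apply integral_congr_ae
    filter_upwards [coe_weightedOp _ hw₁ besselOp C hC₁ h, coe_weightedOp _ hw₂ besselOp C hC₂ k]
      with x h1 h2
    rw [hT₁, hT₂, h1, h2, hpt]
  have h₂₁ : ∀ h k, inner ℂ (T₂ h) (T₁ k) =
      ∫ x, (V x : ℂ) * (conj (besselOp h x) * besselOp k x) := by
    intro h k
    rw [inner_eq_integral]
    apply integral_congr_ae
    filter_upwards [coe_weightedOp _ hw₂ besselOp C hC₂ h, coe_weightedOp _ hw₁ besselOp C hC₁ k]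
      with x h1 h2
    rw [hT₁, hT₂, h1, h2, hpt']
  refine ⟨T₁.adjoint ∘L T₂, fun h k => ?_, fun h k => ?_, fun h φ => ?_⟩
  · rw [ContinuousLinearMap.comp_apply, ContinuousLinearMap.adjoint_inner_right, h₁₂]
  · rw [ContinuousLinearMap.comp_apply, ContinuousLinearMap.comp_apply,
      ContinuousLinearMap.adjoint_inner_right, ContinuousLinearMap.adjoint_inner_left, h₁₂, h₂₁]
  · set ψ := 𝓕 (SchwartzMap.smulLeftCLM ℂ
      (fun x : R3 => (((1 + ‖x‖ ^ 2) ^ ((1 : ℝ) / 2) : ℝ) : ℂ)) (𝓕⁻ φ)) with hψ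
    have hR : besselOp (star (ψ.toLp 2)) = star (φ.toLp 2) := besselOp_star_toLp φ
    have hae : (fun x => conj (T₁ (star (ψ.toLp 2)) x) * T₂ h x) =ᵐ[volume]
        fun x => φ x * potential V (besselOp h) x := by
      filter_upwards [coe_weightedOp _ hw₁ besselOp C hC₁ (star (ψ.toLp 2)),
        coe_weightedOp _ hw₂ besselOp C hC₂ h, Lp.coeFn_star (φ.toLp 2 : L2), φ.coeFn_toLp 2]
        with x h1 h2 h3 h4
      rw [hT₁, hT₂, h1, h2, hpt, hR, h3, Pi.star_apply, h4, RCLike.star_def, Complex.conj_conj,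
        potential]
      ring
    have hint : Integrable (fun x => conj (T₁ (star (ψ.toLp 2)) x) * T₂ h x) :=
      integrable_conj_mul _ _
    refine ⟨hint.congr hae, ?_⟩
    rw [← integral_congr_ae hae, ← inner_eq_integral, ← ContinuousLinearMap.adjoint_inner_right,
      inner_eq_integral]
    change toDist (T₁.adjoint (T₂ h)) ψ = _
    rw [toDist_apply]
    apply integral_congr_ae
    filter_upwards [Lp.coeFn_star (ψ.toLp 2 : L2), ψ.coeFn_toLp 2] with x h1 h2
    rw [h1, Pi.star_apply, h2, RCLike.star_def, Complex.conj_conj]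

/-- The products `V u`, for `u` in `H¹`, are tempered distributions. -/
theorem KatoClass.isRegular_potential {V : R3 → ℝ} (hV : KatoClass V) {u : L2} (hu : u ∈ H1) :
    IsRegular (potential V u) (regular (potential V u)) := by
  obtain ⟨h, rfl⟩ := mem_H1_iff.mp hu
  obtain ⟨Q, -, -, hQ⟩ := hV.exists_potentialOp
  exact (hQ h).isRegular_regular

/-! ### The shifted Hamiltonian as an operator on `L²` -/

lemma neg_laplacian_add_besselOp (b : ℂ) (h : L2) :
    -Δ (toDist (besselOp h)) + b • toDist (besselOp h) =
      TemperedDistribution.besselPotential R3 ℂ 1 (toDist (((4 * π ^ 2 : ℝ) : ℂ) • h +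
        (b - ((4 * π ^ 2 : ℝ) : ℂ)) • besselOp (besselOp h))) := by
  have hB : ∀ T : 𝓢'(R3, ℂ), TemperedDistribution.besselPotential R3 ℂ 2 T =
      T + TemperedDistribution.fourierMultiplierCLM ℂ
        (fun x : R3 => Complex.ofReal (‖x‖ ^ 2)) T := by
    intro T
    have h1 : (fun x : R3 => (((1 + ‖x‖ ^ 2) ^ ((2 : ℝ) / 2) : ℝ) : ℂ)) =
        (fun _ : R3 => (1 : ℂ)) + fun x : R3 => Complex.ofReal (‖x‖ ^ 2) := by
      ext x
      simp
    rw [TemperedDistribution.besselPotential, h1, TemperedDistribution.fourierMultiplierCLM_apply,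
      TemperedDistribution.smulLeftCLM_add (by fun_prop) (by fun_prop), add_apply,
      fourierInv_add, TemperedDistribution.smulLeftCLM_const, one_smul,
      TemperedDistribution.fourierMultiplierCLM_apply]
    congr 1
    exact fourierInv_fourier_eq T
  have hL : Δ (toDist (besselOp h)) = -((4 * π ^ 2 : ℝ) : ℂ) •
      (TemperedDistribution.besselPotential R3 ℂ 1 (toDist h) - toDist (besselOp h)) := by
    have h2 : TemperedDistribution.besselPotential R3 ℂ 1 (toDist h) =
        TemperedDistribution.besselPotential R3 ℂ 2 (toDist (besselOp h)) := by
      rw [toDist_besselOp, TemperedDistribution.besselPotential_besselPotential_apply]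
      norm_num
    rw [h2, hB, add_sub_cancel_left, TemperedDistribution.laplacian_eq_fourierMultiplierCLM]
    ext φ
    change (-(2 * π) ^ 2 : ℝ) • (TemperedDistribution.fourierMultiplierCLM ℂ
      (fun x : R3 => Complex.ofReal (‖x‖ ^ 2)) (toDist (besselOp h))) φ =
      (-((4 * π ^ 2 : ℝ) : ℂ)) • (TemperedDistribution.fourierMultiplierCLM ℂ
      (fun x : R3 => Complex.ofReal (‖x‖ ^ 2)) (toDist (besselOp h))) φ
    rw [Complex.real_smul, smul_eq_mul]
    push_cast
    ring
  have h3 : TemperedDistribution.besselPotential R3 ℂ 1 (toDist (besselOp (besselOp h))) =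
      toDist (besselOp h) := by
    rw [toDist_besselOp (besselOp h), TemperedDistribution.besselPotential_besselPotential_apply]
    simp
  rw [toDist_add, toDist_smul, toDist_smul, map_add, map_smul, map_smul, h3, hL]
  module

/-- In terms of `besselOp`, the operator `𝓗 + a + 1 : H¹ → H⁻¹` becomes a symmetric, invertible
operator on `L²`. -/
theorem KatoClass.exists_shiftedOp {V : R3 → ℝ} (hV : KatoClass V) {a : ℝ} (ha : FormBound V a) :
    ∃ B : L2 →L[ℂ] L2, IsUnit B ∧ (∀ h k, inner ℂ (B h) k = inner ℂ h (B k)) ∧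
      ∀ h, shifted V a (besselOp h) =
        TemperedDistribution.besselPotential R3 ℂ 1 (toDist (B h)) := by
  obtain ⟨Q, hQ, hQs, hQV⟩ := hV.exists_potentialOp
  set m : ℝ := 4 * π ^ 2 with hm
  set B : L2 →L[ℂ] L2 := (m : ℂ) • ContinuousLinearMap.id ℂ L2 +
    ((a + 1 - m : ℝ) : ℂ) • (besselOp ∘L besselOp) + Q with hB
  have hBa : ∀ h, B h = (m : ℂ) • h + ((a + 1 - m : ℝ) : ℂ) • besselOp (besselOp h) + Q h :=
    fun h => rfl
  refine ⟨B, ?_, fun h k => ?_, fun h => ?_⟩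
  · apply ContinuousLinearMap.isUnit_of_forall_le_norm_inner_map B (c := 1) one_pos
    intro h
    obtain ⟨g, hg⟩ := exists_hasGradient (besselOp_mem_H1 h)
    obtain ⟨-, hlow, -⟩ := ha _ (besselOp_mem_H1 h) g hg
    have hQh : inner ℂ (Q h) h = ((∫ x, V x * ‖besselOp h x‖ ^ 2 : ℝ) : ℂ) := by
      rw [hQs, hQ, ← integral_complex_ofReal]
      congr 1
      ext x
      rw [Complex.conj_mul']
      push_cast; rfl
    have hin : inner ℂ (B h) h = ((m * ‖h‖ ^ 2 + (a + 1 - m) * ‖besselOp h‖ ^ 2 +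
        ∫ x, V x * ‖besselOp h x‖ ^ 2 : ℝ) : ℂ) := by
      rw [hBa, inner_add_left, inner_add_left, inner_smul_left, inner_smul_left, inner_besselOp,
        hQh, inner_self_eq_norm_sq_to_K, inner_self_eq_norm_sq_to_K, Complex.conj_ofReal,
        Complex.conj_ofReal]
      push_cast; rfl
    have hs := hg.sum_norm_sq_add
    have hn : ‖besselOp h‖ ^ 2 ≤ ‖h‖ ^ 2 := by
      gcongr
      exact norm_besselOp_le h
    have hpi : 1 ≤ m / 2 := by
      rw [hm]; nlinarith [Real.pi_gt_three]
    rw [hin, Complex.norm_real, NNReal.coe_one, mul_one]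
    refine le_trans ?_ (le_abs_self _)
    rw [← hm] at hs
    nlinarith
  · rw [hBa, hBa, inner_add_left, inner_add_left, inner_add_right, inner_add_right, hQs,
      inner_smul_left, inner_smul_left, inner_smul_right, inner_smul_right, inner_besselOp,
      inner_besselOp, Complex.conj_ofReal, Complex.conj_ofReal]
  · rw [shifted, hamiltonian, (hQV h).regular_eq, hBa, toDist_add, map_add, add_right_comm,
      neg_laplacian_add_besselOp]
    rw [hm]
    push_cast
    rfl

/-! ### Self-adjointness -/

/-- If `K` is an injective bounded symmetric operator, then `K⁻¹ - c`, defined on the range of `K`,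
is self-adjoint for every real `c`. -/
theorem exists_isSelfAdjoint_inverse_sub {E : Type*} [NormedAddCommGroup E] [InnerProductSpace ℂ E]
    [CompleteSpace E] (K : E →L[ℂ] E) (hK : Function.Injective K)
    (hs : ∀ x y, inner ℂ (K x) y = inner ℂ x (K y)) (c : ℝ) :
    ∃ A : E →ₗ.[ℂ] E, (A.domain : Set E) = Set.range K ∧
      (∀ (u : A.domain) (x : E), (u : E) = K x → A u = x - (c : ℂ) • K x) ∧ IsSelfAdjoint A := by
  set e := LinearEquiv.ofInjective (K : E →ₗ[ℂ] E) hK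
  set A : E →ₗ.[ℂ] E := ⟨LinearMap.range (K : E →ₗ[ℂ] E),
    (e.symm : _ →ₗ[ℂ] E) - (c : ℂ) • Submodule.subtype _⟩
  have hdom : (A.domain : Set E) = Set.range K := LinearMap.coe_range _
  have hAK : ∀ (u : A.domain) (x : E), (u : E) = K x → A u = x - (c : ℂ) • K x := by
    intro u x hu
    have h1 : e x = u := Subtype.ext hu.symm
    change e.symm u - (c : ℂ) • (u : E) = _
    rw [← hu, ← h1, LinearEquiv.symm_apply_apply]
  have hex : ∀ u : A.domain, ∃ x, (u : E) = K x := by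
    rintro ⟨u, x, hx⟩
    exact ⟨x, hx.symm⟩
  have hmem : ∀ x, K x ∈ A.domain := fun x => ⟨x, rfl⟩
  have hdense : Dense (A.domain : Set E) := by
    rw [Submodule.dense_iff_topologicalClosure_eq_top, Submodule.topologicalClosure_eq_top_iff,
      Submodule.eq_bot_iff]
    intro v hv
    apply hK
    rw [map_zero]
    apply ext_inner_left ℂ
    intro x
    rw [← hs, inner_zero_right]
    exact (Submodule.mem_orthogonal _ _).mp hv _ (hmem x)
  refine ⟨A, hdom, hAK, ?_⟩
  rw [LinearPMap.isSelfAdjoint_def]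
  have hsymm : A.IsFormalAdjoint A := by
    intro u v
    obtain ⟨x, hx⟩ := hex u
    obtain ⟨y, hy⟩ := hex v
    rw [hAK u x hx, hAK v y hy, hx, hy, inner_sub_left, inner_sub_right, inner_smul_left,
      inner_smul_right, hs, hs x y, Complex.conj_ofReal]
  have hle : A ≤ A.adjoint := LinearPMap.IsFormalAdjoint.le_adjoint hdense hsymm
  refine (LinearPMap.eq_of_le_of_domain_eq hle (le_antisymm hle.1 ?_)).symm
  intro v hv
  have hadj := LinearPMap.adjoint_isFormalAdjoint hdense ⟨v, hv⟩
  set w := A.adjoint ⟨v, hv⟩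
  have hv' : v = K (w + (c : ℂ) • v) := by
    apply ext_inner_right ℂ
    intro x
    have h1 := hadj ⟨K x, hmem x⟩
    rw [hAK ⟨K x, hmem x⟩ x rfl] at h1
    simp only [inner_sub_right, inner_smul_right] at h1
    rw [hs, inner_add_left, inner_smul_left, h1, Complex.conj_ofReal]
    ring
  rw [hv']
  exact hmem _

theorem KatoClass.bijOn_shifted {V : R3 → ℝ} (hV : KatoClass V) {a : ℝ} (ha : FormBound V a) :
    Set.BijOn (shifted V a) H1 Hneg1 := by
  obtain ⟨B, hB, -, hBV⟩ := hV.exists_shiftedOp ha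
  have hbij := ContinuousLinearMap.isUnit_iff_bijective.mp hB
  refine ⟨fun u hu => ?_, fun u hu v hv huv => ?_, fun T hT => ?_⟩
  · obtain ⟨h, rfl⟩ := mem_H1_iff.mp hu
    exact mem_Hneg1_iff.mpr ⟨B h, hBV h⟩
  · obtain ⟨h, rfl⟩ := mem_H1_iff.mp hu
    obtain ⟨k, rfl⟩ := mem_H1_iff.mp hv
    rw [hBV, hBV, ← TemperedDistribution.besselPotential_neg_apply_eq_iff,
      TemperedDistribution.besselPotential_besselPotential_apply] at huv
    have h1 : B h = B k := toDist_injective (by simpa using huv.symm)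
    rw [hbij.1 h1]
  · obtain ⟨k, rfl⟩ := mem_Hneg1_iff.mp hT
    obtain ⟨h, rfl⟩ := hbij.2 k
    exact ⟨besselOp h, besselOp_mem_H1 h, hBV h⟩

theorem KatoClass.exists_isSelfAdjoint {V : R3 → ℝ} (hV : KatoClass V) {a : ℝ}
    (ha : FormBound V a) :
    ∃ A : L2 →ₗ.[ℂ] L2, (A.domain : Set L2) = h2 V a ∧
      (∀ u : A.domain, toDist (A u) = hamiltonian V (u : L2)) ∧ IsSelfAdjoint A := by
  obtain ⟨B, hB, hBs, hBV⟩ := hV.exists_shiftedOp ha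
  have hbij := ContinuousLinearMap.isUnit_iff_bijective.mp hB
  obtain ⟨B', hB'⟩ := hB.exists_right_inv
  have hBB' : ∀ f, B (B' f) = f := fun f => congrArg (fun T : L2 →L[ℂ] L2 => T f) hB'
  set K : L2 →L[ℂ] L2 := besselOp ∘L B' ∘L besselOp
  have hKa : ∀ f, K f = besselOp (B' (besselOp f)) := fun f => rfl
  have hshift : ∀ f, shifted V a (K f) = toDist f := by
    intro f
    rw [hKa, hBV, hBB', toDist_besselOp,
      TemperedDistribution.besselPotential_besselPotential_apply]
    simp
  have hKi : Function.Injective K := by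
    intro f g hfg
    apply toDist_injective
    rw [← hshift, hfg, hshift]
  have hKs : ∀ f g, inner ℂ (K f) g = inner ℂ f (K g) := by
    intro f g
    rw [hKa, hKa, inner_besselOp, ← inner_besselOp f]
    conv_lhs => rw [← hBB' (besselOp g)]
    rw [← hBs, hBB']
  obtain ⟨A, hdom, hA, hsa⟩ := exists_isSelfAdjoint_inverse_sub K hKi hKs (a + 1)
  refine ⟨A, ?_, fun u => ?_, hsa⟩
  · rw [hdom]
    ext u
    constructor
    · rintro ⟨f, rfl⟩
      exact ⟨besselOp_mem_H1 _, f, (hshift f).symm⟩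
    · rintro ⟨hu, f, hf⟩
      refine ⟨f, (hV.bijOn_shifted ha).injOn (besselOp_mem_H1 _) hu ?_⟩
      exact (hshift f).trans hf
  · obtain ⟨f, hf⟩ : (u : L2) ∈ Set.range K := hdom ▸ u.2
    rw [hA u f hf.symm, toDist_sub, toDist_smul, ← hshift, hf, shifted]
    push_cast
    abel

end

end Schrodinger

theorem lemma2p3 (V : Schrodinger.R3 → ℝ) (hV : Schrodinger.KatoClass V) :
    -- the quadratic form bound holds for all sufficiently large constants
    (∃ a₀ : ℝ, ∀ a : ℝ, a₀ ≤ a → Schrodinger.FormBound V a) ∧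
    -- the product `V u` is a tempered distribution for `u` in `H¹`
    (∀ u ∈ Schrodinger.H1, Schrodinger.IsRegular (Schrodinger.potential V u)
      (Schrodinger.regular (Schrodinger.potential V u))) ∧
    ∀ a : ℝ, Schrodinger.FormBound V a →
      -- `𝓗 + a + 1` is invertible from `H¹` onto `H⁻¹`
      Set.BijOn (Schrodinger.shifted V a) Schrodinger.H1 Schrodinger.Hneg1 ∧
      -- the operator `𝓗` in `L²` with domain `(𝓗 + a + 1)⁻¹(L²)` is self-adjoint
      ∃ A : Schrodinger.L2 →ₗ.[ℂ] Schrodinger.L2,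
        (A.domain : Set Schrodinger.L2) = Schrodinger.h2 V a ∧
        (∀ u : A.domain, Schrodinger.toDist (A u) = Schrodinger.hamiltonian V (u : Schrodinger.L2)) ∧
        IsSelfAdjoint A := by
  refine ⟨hV.exists_formBound, fun u hu => hV.isRegular_potential hu, fun a ha => ?_⟩
  exact ⟨hV.bijOn_shifted ha, hV.exists_isSelfAdjoint ha⟩
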